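/- Let $K$ be an algebraically closed field of characteristic $0$ and $\mathbb{P}^3=\mathbb{P}^3_K$. Let $S(\mathbb{P}^3,5)$ be the set of all subsets of $\mathbb{P}^3$ of cardinality $5$ with its Zariski topology (the quotient, under $(p_1,\dots,p_5)\mapsto\{p_1,\dots,p_5\}$, of the Zariski topology on the set of $5$-tuples of distinct points in the product variety $(\mathbb{P}^3)^5$). For $S\in S(\mathbb{P}^3,5)$ let $2S$ be the union of the double points $2p$, $p\in S$, where $2p$ is defined by the square of the ideal sheaf of $p$, and let $\mathcal{I}_{2S}$ be its ideal sheaf. The Terracini locus is $$\mathbb{T}(3,3;5)=\{S\in S(\mathbb{P}^3,5) : \langle S\rangle=\mathbb{P}^3,\ h^0(\mathcal{I}_{2S}(3))>0,\ h^1(\mathcal{I}_{2S}(3))>0\}.$$ Then $\mathbb{T}(3,3;5)$ is irreducible of dimension $14$, and it is formed by all $S\in S(\mathbb{P}^3,5)$ such that $\langle S\rangle=\mathbb{P}^3$ and $4$ of the points of $S$ are coplanar. The action of $PGL(4)=PGL_4(K)$ on $S(\mathbb{P}^3,5)$ sends $\mathbb{T}(3,3;5)$ into itself, with exactly two orbits: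 an orbit $\Phi$ of dimension $13$, formed by all $S\in\mathbb{T}(3,3;5)$ containing $3$ collinear points, and the orbit $\mathbb{T}(3,3;5)\setminus\Phi$, which is open in $\mathbb{T}(3,3;5)$. -/

import Mathlib

open scoped LinearAlgebra.Projectivization

/-! ### The space `S(ℙⁿ, x)` of `x`-point subsets of `ℙⁿ`, with its Zariski topology -/

/-- The set `ℙⁿ[x]` of ordered `x`-tuples of distinct points of `ℙⁿ` over `K`. -/
structure OrderedPoints (K : Type*) [Field K] (n x : ℕ) where
  /-- The points of the tuple. -/
  point : Fin x → ℙ K (Fin (n + 1) → K)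
  /-- The points are distinct. -/
  injective : Function.Injective point

/-- The set `S(ℙⁿ, x)` of all `A ⊆ ℙⁿ` of cardinality `x`. -/
def PointSet (K : Type*) [Field K] (n x : ℕ) : Type _ :=
  Set.powersetCard (ℙ K (Fin (n + 1) → K)) x

/-- A polynomial in `x` groups of `n + 1` variables is multihomogeneous if it is homogeneous in
each group of variables `(i, 0), …, (i, n)` separately. -/
def IsMultihomogeneous {K : Type*} [Field K] {n x : ℕ}
    (f : MvPolynomial (Fin x × Fin (n + 1)) K) : Prop :=
  ∃ m : Fin x → ℕ,
    f.IsWeightedHomogeneous (fun ij : Fin x × Fin (n + 1) => (Pi.single ij.1 1 : Fin x → ℕ)) m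

/-- The set of tuples in `ℙⁿ[x]` at which `f` does not vanish.  For multihomogeneous `f` this does
not depend on the choice of homogeneous coordinates. -/
def nonvanishingLocus {K : Type*} [Field K] {n x : ℕ}
    (f : MvPolynomial (Fin x × Fin (n + 1)) K) : Set (OrderedPoints K n x) :=
  {p | MvPolynomial.eval (fun ij : Fin x × Fin (n + 1) => (p.point ij.1).rep ij.2) f ≠ 0}

/-- The Zariski topology on `ℙⁿ[x]`, a subspace of the product variety `(ℙⁿ)ˣ`: it is generated by
(and has as a basis) the nonvanishing loci of multihomogeneous polynomials. -/
instance OrderedPoints.zariski (K : Type*) [Field K] (n x : ℕ) :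
    TopologicalSpace (OrderedPoints K n x) :=
  TopologicalSpace.generateFrom {U | ∃ f : MvPolynomial (Fin x × Fin (n + 1)) K,
    IsMultihomogeneous f ∧ U = nonvanishingLocus f}

/-- The map `ℙⁿ[x] → S(ℙⁿ, x)`, `(p₁, …, pₓ) ↦ {p₁, …, pₓ}`. -/
def forgetOrder (K : Type*) [Field K] (n x : ℕ) (p : OrderedPoints K n x) : PointSet K n x :=
  Set.powersetCard.ofFinEmb x (ℙ K (Fin (n + 1) → K)) ⟨p.point, p.injective⟩

/-- The Zariski topology on `S(ℙⁿ, x)`, the quotient of `ℙⁿ[x]` by the symmetric group: it is the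
quotient topology. -/
instance PointSet.zariski (K : Type*) [Field K] (n x : ℕ) : TopologicalSpace (PointSet K n x) :=
  TopologicalSpace.coinduced (forgetOrder K n x) (OrderedPoints.zariski K n x)

open scoped Classical in
/-- A group acting on `ℙⁿ` acts on `S(ℙⁿ, x)` by `g • S = {g • p | p ∈ S}`. -/
noncomputable instance PointSet.mulAction {G : Type*} [Group G] (K : Type*) [Field K] (n x : ℕ)
    [MulAction G (ℙ K (Fin (n + 1) → K))] : MulAction G (PointSet K n x) :=
  inferInstanceAs (MulAction G (Set.powersetCard (ℙ K (Fin (n + 1) → K)) x))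

/-- A set of points of a projective space is coplanar if it is contained in a linear subspace of
projective dimension at most `2`. -/
def IsCoplanar {K V : Type*} [Field K] [AddCommGroup V] [Module K V] (A : Set (ℙ K V)) : Prop :=
  ∃ M : Projectivization.Subspace K V,
    Module.Finite K M.submodule ∧ Module.finrank K M.submodule ≤ 3 ∧ A ⊆ M

/-! ### Cohomology of the twisted ideal sheaf `ℐ(d)` on `ℙⁿ`

For a homogeneous ideal `I` of `R = K[x₀, …, xₙ]` with associated ideal sheaf `ℐ`, the cohomology
of `ℐ(d)` is computed by the Čech complex of the standard affine cover of `ℙⁿ`.  All groups of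
sections are realised inside the fraction field of `R`, so that restriction maps are inclusions. -/

/-- The space of sections of `ℐ(d)` over `⋂ i ∈ T, {xᵢ ≠ 0}`: the elements of degree `d` of the
localization of `I` at `∏ i ∈ T, xᵢ`, that is, the fractions `a / (∏ i ∈ T, xᵢ) ^ N` with `a ∈ I`
homogeneous of degree `d + N * #T`. -/
noncomputable def twistedSections {K : Type*} [Field K] {n : ℕ}
    (I : Ideal (MvPolynomial (Fin (n + 1)) K)) (d : ℕ) (T : Finset (Fin (n + 1))) :
    Submodule K (FractionRing (MvPolynomial (Fin (n + 1)) K)) where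
  carrier := {s | ∃ (N : ℕ) (a : MvPolynomial (Fin (n + 1)) K),
    a ∈ I ∧ a.IsHomogeneous (d + N * T.card) ∧
      s * algebraMap (MvPolynomial (Fin (n + 1)) K) (FractionRing (MvPolynomial (Fin (n + 1)) K))
        ((∏ i ∈ T, MvPolynomial.X i) ^ N) = algebraMap (MvPolynomial (Fin (n + 1)) K)
          (FractionRing (MvPolynomial (Fin (n + 1)) K)) a}
  zero_mem' := ⟨0, 0, I.zero_mem, MvPolynomial.isHomogeneous_zero _ _ _, by simp⟩
  add_mem' := by
    rintro s t ⟨N, a, ha, ha', hs⟩ ⟨M, b, hb, hb', ht⟩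
    have hX : ∀ L : ℕ, ((∏ i ∈ T, MvPolynomial.X i : MvPolynomial (Fin (n + 1)) K) ^ L).IsHomogeneous
        (L * T.card) := by
      intro L
      have h := MvPolynomial.IsHomogeneous.prod T
        (fun i => (MvPolynomial.X i : MvPolynomial (Fin (n + 1)) K)) (fun _ => 1)
        (fun i _ => MvPolynomial.isHomogeneous_X K i)
      have h' := h.pow L
      simpa [mul_comm] using h'
    refine ⟨N + M, a * (∏ i ∈ T, MvPolynomial.X i) ^ M + b * (∏ i ∈ T, MvPolynomial.X i) ^ N,
      I.add_mem (I.mul_mem_right _ ha) (I.mul_mem_right _ hb), ?_, ?_⟩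
    · refine MvPolynomial.IsHomogeneous.add ?_ ?_
      · have h := ha'.mul (hX M)
        rwa [show d + N * T.card + M * T.card = d + (N + M) * T.card by ring] at h
      · have h := hb'.mul (hX N)
        rwa [show d + M * T.card + N * T.card = d + (N + M) * T.card by ring] at h
    · rw [map_add, map_mul, map_mul, ← hs, ← ht, pow_add, map_mul]
      ring
  smul_mem' := by
    rintro c s ⟨N, a, ha, ha', hs⟩
    refine ⟨N, MvPolynomial.C c * a, I.mul_mem_left _ ha, ?_, ?_⟩
    · simpa using (MvPolynomial.isHomogeneous_C (Fin (n + 1)) c).mul ha'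
    · rw [map_mul, ← hs, Algebra.smul_def, mul_assoc]
      rfl

/-- The Čech `q`-cochains of `ℐ(d)`: families `c` indexed by `σ = (σ₀, …, σ_q)` with `c σ` a section
of `ℐ(d)` over `{x_{σ₀} ≠ 0} ∩ … ∩ {x_{σ_q} ≠ 0}`. -/
noncomputable def cechCochains {K : Type*} [Field K] {n : ℕ}
    (I : Ideal (MvPolynomial (Fin (n + 1)) K)) (d q : ℕ) :
    Submodule K ((Fin (q + 1) → Fin (n + 1)) → FractionRing (MvPolynomial (Fin (n + 1)) K)) :=
  Submodule.pi Set.univ fun σ => twistedSections I d (Finset.univ.image σ)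

/-- The Čech differential
`(δ c)(σ₀, …, σ_{q+1}) = ∑ k, (-1)ᵏ c(σ₀, …, σ_{k-1}, σ_{k+1}, …, σ_{q+1})`. -/
noncomputable def cechDifferential (K : Type*) [Field K] (n q : ℕ) :
    ((Fin (q + 1) → Fin (n + 1)) → FractionRing (MvPolynomial (Fin (n + 1)) K)) →ₗ[K]
      ((Fin (q + 2) → Fin (n + 1)) → FractionRing (MvPolynomial (Fin (n + 1)) K)) :=
  ∑ k : Fin (q + 2), ((-1 : K) ^ (k : ℕ)) •
    LinearMap.funLeft K (FractionRing (MvPolynomial (Fin (n + 1)) K))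
      (fun σ : Fin (q + 2) → Fin (n + 1) => σ ∘ k.succAbove)

/-- The Čech `q`-cocycles of `ℐ(d)`. -/
noncomputable def cechCocycles {K : Type*} [Field K] {n : ℕ}
    (I : Ideal (MvPolynomial (Fin (n + 1)) K)) (d q : ℕ) :
    Submodule K ((Fin (q + 1) → Fin (n + 1)) → FractionRing (MvPolynomial (Fin (n + 1)) K)) :=
  cechCochains I d q ⊓ LinearMap.ker (cechDifferential K n q)

/-- The Čech `q`-coboundaries of `ℐ(d)`. -/
noncomputable def cechCoboundaries {K : Type*} [Field K] {n : ℕ}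
    (I : Ideal (MvPolynomial (Fin (n + 1)) K)) (d : ℕ) : (q : ℕ) →
    Submodule K ((Fin (q + 1) → Fin (n + 1)) → FractionRing (MvPolynomial (Fin (n + 1)) K))
  | 0 => ⊥
  | q + 1 => (cechCochains I d q).map (cechDifferential K n q)

/-- `hᑫ(ℐ(d))`, the dimension over `K` of `Hᑫ(ℙⁿ, ℐ(d))`. -/
noncomputable def cohomologyDim {K : Type*} [Field K] {n : ℕ}
    (I : Ideal (MvPolynomial (Fin (n + 1)) K)) (d q : ℕ) : Cardinal :=
  Module.rank K (cechCocycles I d q ⧸ (cechCoboundaries I d q).submoduleOf (cechCocycles I d q))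

/-! ### The Terracini locus -/

/-- The homogeneous ideal of a point of `ℙⁿ`: the polynomials vanishing on the corresponding line
of `Kⁿ⁺¹`. -/
noncomputable def pointIdeal {K : Type*} [Field K] {n : ℕ} (p : ℙ K (Fin (n + 1) → K)) :
    Ideal (MvPolynomial (Fin (n + 1)) K) :=
  MvPolynomial.vanishingIdeal K (p.submodule : Set (Fin (n + 1) → K))

/-- The homogeneous ideal of the scheme `2S`, the union over `p ∈ S` of the double points `2p`
(`2p` being defined by the square of the ideal of `p`). -/
noncomputable def doublePointsIdeal {K : Type*} [Field K] {n x : ℕ} (S : PointSet K n x) :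
    Ideal (MvPolynomial (Fin (n + 1)) K) :=
  ⨅ p ∈ S.1, pointIdeal p ^ 2

/-- `S` spans `ℙⁿ`. -/
def PointSet.Spans {K : Type*} [Field K] {n x : ℕ} (S : PointSet K n x) : Prop :=
  Projectivization.Subspace.span (S.1 : Set (ℙ K (Fin (n + 1) → K))) = ⊤

/-- The Terracini locus `𝕋(n, d; x)`. -/
def terraciniLocus (K : Type*) [Field K] (n d x : ℕ) : Set (PointSet K n x) :=
  {S | S.Spans ∧ 0 < cohomologyDim (doublePointsIdeal S) d 0 ∧
    0 < cohomologyDim (doublePointsIdeal S) d 1}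

/-- The set `Φ` of all `S ∈ 𝕋(n, d; x)` containing `3` collinear points. -/
def collinearTerracini (K : Type*) [Field K] (n d x : ℕ) : Set (PointSet K n x) :=
  {S | S ∈ terraciniLocus K n d x ∧
    ∃ A ⊆ S.1, A.card = 3 ∧ Projectivization.IsCollinear (A : Set (ℙ K (Fin (n + 1) → K)))}

/-! Everything is reduced to linear relations between vectors `v 0, …, v 4` that represent the five
points. A set of `m + 1` of the points lies in a linear subspace of vector dimension `m` exactly
when there is a nontrivial relation with at most `m + 1` nonzero coefficients inside that set
(`exists_subset_mem_subspace_iff`).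

Cohomology. Suppose a nonzero cubic is singular at five points, no four of them coplanar. In the
basis of the first four points it contains only the monomials `y i * y j * y k` with distinct
indices, and the singularity at the fifth point, all of whose coordinates are nonzero, kills these
as well (`hasRelation_of_singular_cubic`). Conversely, for four coplanar points in a spanning set, a
union of three planes passes twice through each point, so `h⁰ > 0`. Two lines joining disjoint pairs
of the coplanar points meet, and the value of a cubic at the meeting point can be computed along
either line. This is a linear condition on the 1-jets of cubics at the points, so not every jet
along `2S` is the jet of a cubic, and `h¹ > 0`.

Orbits. Rescaling and reordering bring a spanning configuration with four coplanar points to the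
form `b 0, b 1, b 2, b 3, b 0 + b 1 + a • b 2` with `b` a basis and `a` equal to `0` or `1`
(`exists_configVectors`). The linear group is transitive on bases, and `a = 0` means that three
points are collinear. This gives the two orbits. Letting `a` be arbitrary parametrizes the locus by
an open subset of an affine space, hence irreducibility.

Dimension. Dividing by the symmetric group does not change Krull dimension, so ordered tuples can be
used. The Terracini tuples lie in a hypersurface, where a product of five determinants vanishes.
Comparing with chains of primes in a polynomial ring in 20 variables through multicones gives
dimension at most 14. An explicit chain of irreducible families gives `dim Φ ≥ 13`. As `Φ` is closed
and proper in the irreducible Terracini locus, the dimension of the locus is at least `dim Φ + 1`.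
Both dimensions follow. -/

/-! ### Krull dimension of quotients by finite groups -/

section FiniteQuotient

open TopologicalSpace
open scoped Pointwise

variable {G Y Z : Type*} [Group G] [Finite G] [TopologicalSpace Y] [MulAction G Y]
  [ContinuousConstSMul G Y] [TopologicalSpace Z] {q : Y → Z}

/-- A closed irreducible set lifts along a closed map with finite fibres. -/
theorem IsClosedMap.exists_irreducibleCloseds_image_eq {Y Z : Type*} [TopologicalSpace Y]
    [TopologicalSpace Z] {q : Y → Z} (hc : Continuous q) (hq : IsClosedMap q)
    (hs : Function.Surjective q) (hf : ∀ z, (q ⁻¹' {z}).Finite) (A : IrreducibleCloseds Z) :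
    ∃ W : IrreducibleCloseds Y, q '' W = A := by
  -- A closed set minimal among those mapping onto `A` is automatically irreducible. Zorn applies
  -- because the fibres are finite.
  obtain ⟨W, hW⟩ := zorn_superset {C : Set Y | IsClosed C ∧ q '' C = A} (by
    intro c hcS hch
    rcases c.eq_empty_or_nonempty with rfl | hne
    · exact ⟨q ⁻¹' A, ⟨A.isClosed.preimage hc, Set.image_preimage_eq _ hs⟩, by simp⟩
    · refine ⟨⋂₀ c, ⟨isClosed_sInter fun C hC => (hcS hC).1, ?_⟩, fun s hs => Set.sInter_subset_of_mem hs⟩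
      apply Set.Subset.antisymm
      · obtain ⟨C, hC⟩ := hne
        rw [← (hcS hC).2]
        exact Set.image_mono (Set.sInter_subset_of_mem hC)
      · intro z hz
        obtain ⟨C, hC, hmin⟩ := exists_minimalFor_of_wellFoundedLT (fun C => C ∈ c)
          (fun C => (C ∩ q ⁻¹' {z}).ncard) hne
        have hzC : z ∈ q '' C := by rw [(hcS hC).2]; exact hz
        obtain ⟨y, hy, rfl⟩ := hzC
        refine ⟨y, ?_, rfl⟩
        intro C' hC'
        rcases hch.total hC hC' with h | h
        · exact h hy
        · have hsub : C' ∩ q ⁻¹' {q y} ⊆ C ∩ q ⁻¹' {q y} := Set.inter_subset_inter_left _ h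
          have hfin : (C ∩ q ⁻¹' {q y}).Finite := (hf _).subset Set.inter_subset_right
          have h1 := hmin hC' (Set.ncard_le_ncard hsub hfin)
          have h2 := Set.eq_of_subset_of_ncard_le hsub h1 hfin
          have : y ∈ C' ∩ q ⁻¹' {q y} := by rw [h2]; exact ⟨hy, rfl⟩
          exact this.1)
  obtain ⟨⟨hWc, hWA⟩, hmin⟩ := hW
  refine ⟨⟨W, ⟨?_, ?_⟩, hWc⟩, hWA⟩
  · have h := A.isIrreducible.nonempty
    rw [← hWA] at h
    exact h.of_image
  · rw [isPreirreducible_iff_isClosed_union_isClosed]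
    intro z₁ z₂ h1 h2 hsub
    have key : ∀ z : Set Y, IsClosed z → (A : Set Z) ⊆ q '' (W ∩ z) → W ⊆ z := by
      intro z hz hA
      have : W ∩ z ∈ {C : Set Y | IsClosed C ∧ q '' C = A} :=
        ⟨hWc.inter hz, Set.Subset.antisymm
          ((Set.image_mono Set.inter_subset_left).trans hWA.subset) hA⟩
      exact (hmin this Set.inter_subset_left).trans Set.inter_subset_right
    have := isPreirreducible_iff_isClosed_union_isClosed.1 A.isIrreducible.isPreirreducible
      (q '' (W ∩ z₁)) (q '' (W ∩ z₂)) (hq _ (hWc.inter h1)) (hq _ (hWc.inter h2)) (by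
        rw [← Set.image_union, ← Set.inter_union_distrib_left, Set.inter_eq_left.2 hsub, hWA])
    exact this.imp (key _ h1) (key _ h2)

/-- The finitely many closed translates `g • B` cover `A`, and an irreducible set covered by
finitely many closed sets lies in one of them. -/
theorem IsIrreducible.exists_subset_smul {A B : Set Y} (hA : IsIrreducible A) (hB : IsClosed B)
    (h : ∀ y ∈ A, ∃ g : G, g • y ∈ B) : ∃ g : G, A ⊆ g • B := by
  have := Fintype.ofFinite G
  classical
  have h1 := isIrreducible_iff_sUnion_isClosed.1 hA (Finset.univ.image fun g : G => g • B) (by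
    intro z hz
    simp only [Finset.mem_image, Finset.mem_univ, true_and] at hz
    obtain ⟨g, rfl⟩ := hz
    exact hB.smul g) (by
    intro y hy
    obtain ⟨g, hg⟩ := h y hy
    refine Set.mem_sUnion.2 ⟨g⁻¹ • B, by simp, ?_⟩
    rwa [Set.mem_smul_set_iff_inv_smul_mem, inv_inv])
  obtain ⟨z, hz, hAz⟩ := h1
  simp only [Finset.mem_image, Finset.mem_univ, true_and] at hz
  obtain ⟨g, rfl⟩ := hz
  exact ⟨g, hAz⟩

/-- The chain `A ⊆ g • A ⊆ g ^ 2 • A ⊆ …` returns to `A` because `g` has finite order. -/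
theorem Set.smul_eq_of_subset_smul {G Y : Type*} [Group G] [Finite G] [MulAction G Y] {A : Set Y}
    {g : G} (h : A ⊆ g • A) : g • A ⊆ A := by
  have h1 : ∀ n : ℕ, g • A ⊆ g ^ (n + 1) • A := by
    intro n
    induction n with
    | zero => simp
    | succ n ih =>
      calc g • A ⊆ g ^ (n + 1) • A := ih
        _ ⊆ g ^ (n + 1) • g • A := Set.smul_set_mono h
        _ = g ^ (n + 1 + 1) • A := by rw [smul_smul, ← pow_succ]
  obtain ⟨n, hn⟩ := Nat.exists_eq_succ_of_ne_zero (orderOf_pos g).ne'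
  have := h1 n
  rwa [← Nat.succ_eq_add_one, ← hn, pow_orderOf_eq_one, one_smul] at this

/-- The Krull dimension of a quotient by a finite group is that of the space. -/
theorem topologicalKrullDim_eq_of_finite_quotient (hc : Continuous q) (hq : IsClosedMap q)
    (hs : Function.Surjective q) (hfib : ∀ y y' : Y, q y = q y' ↔ ∃ g : G, g • y = y') :
    topologicalKrullDim Y = topologicalKrullDim Z := by
  have hf : ∀ z, (q ⁻¹' {z}).Finite := by
    intro z
    obtain ⟨y, rfl⟩ := hs z
    refine (Set.finite_range fun g : G => g • y).subset ?_
    intro y' hy'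
    exact (hfib y y').1 (Eq.symm hy')
  have lift := hq.exists_irreducibleCloseds_image_eq hc hs hf
  apply le_antisymm
  · let F : IrreducibleCloseds Y → IrreducibleCloseds Z := fun W =>
      ⟨q '' W, W.isIrreducible.image q hc.continuousOn, hq _ W.isClosed⟩
    refine Order.krullDim_le_of_strictMono F fun A B hAB => lt_of_le_not_ge ?_ ?_
    · exact Set.image_mono (s := (A : Set Y)) hAB.le
    · intro hle
      have hle' : q '' (B : Set Y) ⊆ q '' (A : Set Y) := hle
      obtain ⟨g, hg⟩ := B.isIrreducible.exists_subset_smul (G := G) A.isClosed (by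
        intro y hy
        obtain ⟨y', hy', he⟩ := hle' ⟨y, hy, rfl⟩
        obtain ⟨g, rfl⟩ := (hfib y y').1 he.symm
        exact ⟨g, hy'⟩)
      have hAB' : (A : Set Y) ⊆ B := hAB.le
      -- From `A ⊆ B ⊆ g • A` the finite order of `g` gives `g • A ⊆ A`, so `B ⊆ A`: distinct nested
      -- irreducible closed sets have distinct images.
      have h2 := Set.smul_eq_of_subset_smul (hAB'.trans hg)
      exact hAB.not_ge (hg.trans h2)
  · refine iSup_le fun p => ?_
    -- Going up: any lift of `B` has a translate that contains the given lift of `A`.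
    have step : ∀ (A B : IrreducibleCloseds Z) (W : IrreducibleCloseds Y), A ≤ B → q '' W = A →
        ∃ W' : IrreducibleCloseds Y, W ≤ W' ∧ q '' W' = B := by
      intro A B W hAB hW
      obtain ⟨W', hW'⟩ := lift B
      obtain ⟨g, hg⟩ := W.isIrreducible.exists_subset_smul (G := G) W'.isClosed (by
        intro y hy
        have : q y ∈ q '' (W' : Set Y) := by
          rw [hW']; apply hAB; change q y ∈ (A : Set Z); rw [← hW]; exact ⟨y, hy, rfl⟩
        obtain ⟨y', hy', he⟩ := this
        obtain ⟨g, rfl⟩ := (hfib y y').1 he.symm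
        exact ⟨g, hy'⟩)
      refine ⟨⟨g • (W' : Set Y), ?_, W'.isClosed.smul g⟩, hg, ?_⟩
      · exact W'.isIrreducible.image _ (continuous_const_smul g).continuousOn
      · rw [← hW']
        ext z
        constructor
        · rintro ⟨_, ⟨y, hy, rfl⟩, rfl⟩
          exact ⟨y, hy, (hfib _ _).2 ⟨g, rfl⟩⟩
        · rintro ⟨y, hy, rfl⟩
          exact ⟨g • y, ⟨y, hy, rfl⟩, ((hfib _ _).2 ⟨g, rfl⟩).symm⟩
    -- The chain is continued by its last term, so that the lifts can be chosen by recursion on `ℕ`.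
    let p' : ℕ → IrreducibleCloseds Z := fun k => p ⟨min k p.length, by omega⟩
    have hp' : Monotone p' := fun a b hab => p.monotone (by
      rw [Fin.mk_le_mk]; exact min_le_min_right _ hab)
    choose! S hS1 hS2 using step
    obtain ⟨W0, hW0⟩ := lift (p' 0)
    let W : ℕ → IrreducibleCloseds Y := fun k =>
      Nat.rec W0 (fun k w => S (p' k) (p' (k + 1)) w) k
    have hW : ∀ k, q '' (SetLike.coe (W k)) = (p' k : Set Z) := by
      intro k
      induction k with
      | zero => exact hW0
      | succ k ih => exact hS2 _ _ _ (hp' k.le_succ) ih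
    have hmono : Monotone W := monotone_nat_of_le_succ fun k =>
      hS1 _ _ _ (hp' k.le_succ) (hW k)
    let r : LTSeries (IrreducibleCloseds Y) := LTSeries.mk p.length (fun i => W i) (by
      intro i j hij
      refine lt_of_le_of_ne (hmono (Fin.lt_def.1 hij).le) fun he => ?_
      have hi := hW i
      have he' : W i = W j := he
      rw [he', hW j] at hi
      have := SetLike.coe_injective hi
      have hlt := p.strictMono hij
      have e : ∀ i : Fin (p.length + 1), p' i = p i := by
        intro i
        have : min (i : ℕ) p.length = i := by omega
        simp only [p']
        congr 1
        exact Fin.ext this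
      rw [← e i, ← e j, this] at hlt
      exact lt_irrefl _ hlt)
    exact le_iSup_of_le r le_rfl

end FiniteQuotient

/-! ### Ordered tuples of points and representing vectors -/

section Represents

open scoped Pointwise

variable {K : Type*} [Field K] {n x : ℕ}

/-- The vectors `v i` are homogeneous coordinates of the points of `p`. -/
def OrderedPoints.Represents (p : OrderedPoints K n x) (v : Fin x → Fin (n + 1) → K) : Prop :=
  ∀ i, ∃ h : v i ≠ 0, p.point i = Projectivization.mk K (v i) h

theorem OrderedPoints.represents_rep (p : OrderedPoints K n x) :
    p.Represents fun i => (p.point i).rep :=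
  fun i => ⟨(p.point i).rep_nonzero, (p.point i).mk_rep.symm⟩

namespace OrderedPoints.Represents

variable {p : OrderedPoints K n x} {v w : Fin x → Fin (n + 1) → K}

theorem ne_zero (h : p.Represents v) (i : Fin x) : v i ≠ 0 := (h i).1

theorem smul (h : p.Represents v) (c : Fin x → Kˣ) : p.Represents fun i => c i • v i := by
  intro i
  obtain ⟨h0, h1⟩ := h i
  refine ⟨(smul_ne_zero_iff_ne (c i)).2 h0, ?_⟩
  rw [h1, Projectivization.mk_eq_mk_iff]
  exact ⟨(c i)⁻¹, by simp⟩

theorem exists_smul (h : p.Represents v) (h' : p.Represents w) :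
    ∃ c : Fin x → Kˣ, w = fun i => c i • v i := by
  have : ∀ i, ∃ c : Kˣ, c • v i = w i := by
    intro i
    obtain ⟨h0, h1⟩ := h i
    obtain ⟨h0', h1'⟩ := h' i
    rw [h1', Projectivization.mk_eq_mk_iff] at h1
    exact h1
  choose c hc using this
  exact ⟨c, funext fun i => (hc i).symm⟩

theorem eq_of_represents {p' : OrderedPoints K n x} (h : p.Represents v) (h' : p'.Represents v) :
    p = p' := by
  obtain ⟨f, hf⟩ := p
  obtain ⟨f', hf'⟩ := p'
  have : f = f' := funext fun i => (h i).2.trans (h' i).2.symm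
  subst this
  rfl

theorem linearIndependent_pair (h : p.Represents v) {i j : Fin x} (hij : i ≠ j) :
    LinearIndependent K ![v i, v j] := by
  rw [LinearIndependent.pair_iff' (h.ne_zero i)]
  intro a ha
  apply hij
  apply p.injective
  obtain ⟨h0, h1⟩ := h i
  obtain ⟨h0', h1'⟩ := h j
  rw [h1, h1', Eq.comm, Projectivization.mk_eq_mk_iff']
  exact ⟨a, ha⟩

theorem eq_zero_of_pair (h : p.Represents v) {i j : Fin x} (hij : i ≠ j) {a b : K}
    (hab : a • v i + b • v j = 0) : a = 0 ∧ b = 0 :=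
  LinearIndependent.pair_iff.1 (h.linearIndependent_pair hij) a b hab

theorem mem_iff (h : p.Represents v) (i : Fin x)
    (M : Projectivization.Subspace K (Fin (n + 1) → K)) :
    p.point i ∈ M ↔ v i ∈ M.submodule := by
  obtain ⟨h0, h1⟩ := h i
  rw [h1, Projectivization.Subspace.mem_submodule_iff _ h0]

end OrderedPoints.Represents

theorem OrderedPoints.exists_represents {v : Fin x → Fin (n + 1) → K}
    (h : ∀ i j, i ≠ j → LinearIndependent K ![v i, v j]) (h0 : ∀ i, v i ≠ 0) :
    ∃ p : OrderedPoints K n x, p.Represents v := by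
  refine ⟨⟨fun i => Projectivization.mk K (v i) (h0 i), ?_⟩, fun i => ⟨h0 i, rfl⟩⟩
  intro i j hij
  by_contra hne
  obtain ⟨c, hc⟩ := (Projectivization.mk_eq_mk_iff' K _ _ _ _).1 hij
  exact (LinearIndependent.pair_iff' (h0 j)).1 (h j i (Ne.symm hne)) c hc

/-- The symmetric group permutes the points of a tuple. -/
instance OrderedPoints.permAction : MulAction (Equiv.Perm (Fin x)) (OrderedPoints K n x) where
  smul σ p := ⟨p.point ∘ ⇑σ⁻¹, p.injective.comp σ⁻¹.injective⟩
  one_smul _ := rfl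
  mul_smul _ _ _ := rfl

theorem OrderedPoints.smul_point (σ : Equiv.Perm (Fin x)) (p : OrderedPoints K n x) (i : Fin x) :
    (σ • p).point i = p.point (σ⁻¹ i) := rfl

theorem OrderedPoints.Represents.perm {p : OrderedPoints K n x} {v : Fin x → Fin (n + 1) → K}
    (h : p.Represents v) (σ : Equiv.Perm (Fin x)) : (σ⁻¹ • p).Represents fun i => v (σ i) :=
  fun i => by
    obtain ⟨h0, h1⟩ := h (σ i)
    exact ⟨h0, by rw [OrderedPoints.smul_point, inv_inv, h1]⟩

theorem mem_forgetOrder {p : OrderedPoints K n x} {a : ℙ K (Fin (n + 1) → K)} :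
    a ∈ (forgetOrder K n x p).1 ↔ ∃ i, p.point i = a := by
  simp [forgetOrder]

theorem forgetOrder_surjective : Function.Surjective (forgetOrder K n x) := by
  intro S
  obtain ⟨f, hf⟩ := Set.powersetCard.ofFinEmb_surjective x (ℙ K (Fin (n + 1) → K)) S
  exact ⟨⟨f, f.injective⟩, hf⟩

theorem forgetOrder_eq_iff {p p' : OrderedPoints K n x} :
    forgetOrder K n x p = forgetOrder K n x p' ↔ ∃ σ : Equiv.Perm (Fin x), σ • p = p' := by
  constructor
  · intro h
    have h1 : ∀ i, ∃ j, p.point j = p'.point i := by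
      intro i
      rw [← mem_forgetOrder, h, mem_forgetOrder]
      exact ⟨i, rfl⟩
    choose f hf using h1
    have hinj : Function.Injective f := by
      intro i j hij
      apply p'.injective
      rw [← hf i, ← hf j, hij]
    refine ⟨(Equiv.ofBijective f (Finite.injective_iff_bijective.1 hinj))⁻¹, ?_⟩
    obtain ⟨g, hg⟩ := p'
    have : p.point ∘ f = g := funext hf
    subst this
    rfl
  · rintro ⟨σ, rfl⟩
    apply Subtype.ext
    ext a
    rw [mem_forgetOrder, mem_forgetOrder]
    constructor
    · rintro ⟨i, rfl⟩
      exact ⟨σ i, by simp [OrderedPoints.smul_point]⟩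
    · rintro ⟨i, rfl⟩
      exact ⟨_, rfl⟩

/-- A group acting on `ℙⁿ` acts on tuples of points. -/
def OrderedPoints.translate {G : Type*} [Group G] [MulAction G (ℙ K (Fin (n + 1) → K))] (g : G)
    (p : OrderedPoints K n x) : OrderedPoints K n x :=
  ⟨fun i => g • p.point i, fun _ _ h => p.injective (MulAction.injective g h)⟩

theorem smul_forgetOrder {G : Type*} [Group G] [MulAction G (ℙ K (Fin (n + 1) → K))] (g : G)
    (p : OrderedPoints K n x) :
    g • forgetOrder K n x p = forgetOrder K n x (p.translate g) := by
  classical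
  apply Subtype.ext
  ext a
  have : (g • forgetOrder K n x p).1 = g • (forgetOrder K n x p).1 := rfl
  rw [this, mem_forgetOrder, Finset.mem_smul_finset]
  constructor
  · rintro ⟨b, hb, rfl⟩
    obtain ⟨i, rfl⟩ := mem_forgetOrder.1 hb
    exact ⟨i, rfl⟩
  · rintro ⟨i, rfl⟩
    exact ⟨_, mem_forgetOrder.2 ⟨i, rfl⟩, rfl⟩

theorem OrderedPoints.Represents.translate {p : OrderedPoints K n x}
    {v : Fin x → Fin (n + 1) → K} (h : p.Represents v) (g : GL (Fin (n + 1)) K) :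
    (p.translate (Matrix.ProjGenLinGroup.mk g)).Represents fun i => g.1.mulVec (v i) := by
  intro i
  obtain ⟨h0, h1⟩ := h i
  refine ⟨(smul_ne_zero_iff_ne g).2 h0, ?_⟩
  change (Matrix.ProjGenLinGroup.mk g) • p.point i = _
  rw [h1, Projectivization.PGL.mk_smul_mk]
  rfl

theorem forgetOrder_spans_iff {p : OrderedPoints K n x} {v : Fin x → Fin (n + 1) → K}
    (h : p.Represents v) :
    (forgetOrder K n x p).Spans ↔ Submodule.span K (Set.range v) = ⊤ := by
  unfold PointSet.Spans
  constructor
  · intro hS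
    have : (⊤ : Projectivization.Subspace K (Fin (n + 1) → K)) ≤
        (Submodule.span K (Set.range v)).projectivization := by
      rw [← hS, Projectivization.Subspace.span_le_subspace_iff]
      intro a ha
      obtain ⟨i, rfl⟩ := mem_forgetOrder.1 ha
      rw [SetLike.mem_coe, h.mem_iff, OrderIso.apply_symm_apply]
      exact Submodule.subset_span ⟨i, rfl⟩
    exact (map_eq_top_iff (Submodule.projectivization (K := K))).1 (top_le_iff.1 this)
  · intro hv
    have : (⊤ : Submodule K (Fin (n + 1) → K)) ≤ Projectivization.Subspace.submodule
        (Projectivization.Subspace.span ((forgetOrder K n x p).1 : Set (ℙ K (Fin (n + 1) → K)))) := by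
      rw [← hv, Submodule.span_le]
      rintro _ ⟨i, rfl⟩
      rw [SetLike.mem_coe, ← h.mem_iff]
      exact Projectivization.Subspace.subset_span _ (mem_forgetOrder.2 ⟨i, rfl⟩)
    exact (map_eq_top_iff _).1 (top_le_iff.1 this)

/-- `v` has a nontrivial linear relation with at most `m` nonzero coefficients. -/
def HasRelation {V : Type*} [AddCommGroup V] [Module K V] {ι : Type*} [Fintype ι] (v : ι → V)
    (m : ℕ) : Prop :=
  ∃ c : ι → K, c ≠ 0 ∧ ∑ i, c i • v i = 0 ∧ (Function.support c).ncard ≤ m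

/-- For vectors indexed by an `(m + 1)`-element set, lying in a space of dimension at most `m` is
linear dependence. The case `m = 3` treats coplanarity and `m = 2` collinearity. -/
theorem exists_subset_mem_subspace_iff {p : OrderedPoints K n x} {v : Fin x → Fin (n + 1) → K}
    (h : p.Represents v) {m : ℕ} (hm : m < x) :
    (∃ A ⊆ (forgetOrder K n x p).1, A.card = m + 1 ∧
      ∃ M : Projectivization.Subspace K (Fin (n + 1) → K), Module.Finite K M.submodule ∧
        Module.finrank K M.submodule ≤ m ∧ (A : Set (ℙ K (Fin (n + 1) → K))) ⊆ M) ↔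
      HasRelation (K := K) v (m + 1) := by
  classical
  constructor
  · rintro ⟨A, hA, hcard, M, -, hM, hAM⟩
    let J : Finset (Fin x) := Finset.univ.filter fun i => p.point i ∈ A
    have hJA : J.image p.point = A := by
      ext a
      simp only [J, Finset.mem_image, Finset.mem_filter, Finset.mem_univ, true_and]
      constructor
      · rintro ⟨i, hi, rfl⟩; exact hi
      · intro ha
        obtain ⟨i, rfl⟩ := mem_forgetOrder.1 (hA ha)
        exact ⟨i, ha, rfl⟩
    have hJ : J.card = m + 1 := by
      rw [← hcard, ← hJA, Finset.card_image_of_injective _ p.injective]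
    have hdep : ¬ LinearIndepOn K v (J : Set (Fin x)) := by
      intro hli
      have h1 := finrank_span_eq_card (R := K) (b := fun i : (J : Set (Fin x)) => v i) hli
      have h2 : Submodule.span K (Set.range fun i : (J : Set (Fin x)) => v i) ≤ M.submodule := by
        rw [Submodule.span_le]
        rintro _ ⟨⟨i, hi⟩, rfl⟩
        rw [SetLike.mem_coe, ← h.mem_iff]
        exact hAM (Finset.mem_filter.1 hi).2
      have h3 := Submodule.finrank_mono h2
      rw [h1] at h3
      simp only [Finset.coe_sort_coe, Fintype.card_coe] at h3
      omega
    obtain ⟨f, hf, i, hi, hfi⟩ := not_linearIndepOn_finset_iff.1 hdep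
    refine ⟨fun i => if i ∈ J then f i else 0, ?_, ?_, ?_⟩
    · intro h0
      have := congrFun h0 i
      simp [hi, hfi] at this
    · rw [← hf]
      simp [ite_smul, Finset.sum_ite_mem]
    · rw [← hJ, ← Set.ncard_coe_finset]
      refine Set.ncard_le_ncard ?_ (Finset.finite_toSet _)
      intro i hi
      by_contra hiJ
      apply hi
      simp only [Finset.mem_coe] at hiJ
      simp [hiJ]
  · rintro ⟨c, hc, hsum, hcard⟩
    have hle : (Finset.univ.filter fun i => c i ≠ 0).card ≤ m + 1 := by
      rw [← Set.ncard_coe_finset]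
      refine le_trans (le_of_eq ?_) hcard
      congr 1
      ext i
      simp
    -- The support may have fewer than `m + 1` elements; it is enlarged to exactly that size, which
    -- needs `m < x`.
    obtain ⟨J, hJ1, hJ2⟩ := Finset.exists_superset_card_eq hle (by simp; omega)
    have hdep : ¬ LinearIndepOn K v (J : Set (Fin x)) := by
      rw [not_linearIndepOn_finset_iff]
      obtain ⟨i, hi⟩ := Function.ne_iff.1 hc
      refine ⟨c, ?_, i, hJ1 (by simpa using hi), hi⟩
      rw [← hsum]
      refine Finset.sum_subset (Finset.subset_univ _) fun i _ hi => ?_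
      have : c i = 0 := by
        by_contra h0
        exact hi (hJ1 (by simpa using h0))
      simp [this]
    refine ⟨J.image p.point, ?_, ?_,
      (Submodule.span K (Set.range fun i : (J : Set (Fin x)) => v i)).projectivization,
      inferInstance, ?_, ?_⟩
    · intro a ha
      obtain ⟨i, -, rfl⟩ := Finset.mem_image.1 ha
      exact mem_forgetOrder.2 ⟨i, rfl⟩
    · rw [Finset.card_image_of_injective _ p.injective, hJ2]
    · rw [OrderIso.apply_symm_apply]
      by_contra hlt
      apply hdep
      apply linearIndependent_iff_card_le_finrank_span.2
      simp only [Finset.coe_sort_coe, Fintype.card_coe]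
      rw [hJ2]
      change m < Set.finrank K _ 
      exact not_le.1 hlt
    · intro a ha
      obtain ⟨i, hi, rfl⟩ := Finset.mem_image.1 (Finset.mem_coe.1 ha)
      rw [SetLike.mem_coe, h.mem_iff, OrderIso.apply_symm_apply]
      exact Submodule.subset_span ⟨⟨i, hi⟩, rfl⟩

end Represents

/-! ### Normal forms of five points spanning `ℙ³`, four of them coplanar -/

section NormalForm

variable {K : Type*} [Field K]

/-- Distinct points have pairwise nonproportional vectors, which excludes relations with one or two
terms. -/
theorem OrderedPoints.Represents.three_le_ncard_support {n x : ℕ} {p : OrderedPoints K n x}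
    {v : Fin x → Fin (n + 1) → K} (h : p.Represents v) {c : Fin x → K} (hc : c ≠ 0)
    (hsum : ∑ i, c i • v i = 0) : 3 ≤ (Function.support c).ncard := by
  classical
  by_contra hlt
  have hfin : (Function.support c).Finite := Set.toFinite _
  rcases Nat.lt_or_ge (Function.support c).ncard 1 with h0 | h1
  · have : Function.support c = ∅ := (Set.ncard_eq_zero hfin).1 (by omega)
    exact hc (Function.support_eq_empty_iff.1 this)
  have hsum' : ∀ J : Finset (Fin x), (J : Set (Fin x)) = Function.support c →
      ∑ i ∈ J, c i • v i = 0 := by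
    intro J hJ
    rw [← hsum]
    refine Finset.sum_subset (Finset.subset_univ _) fun i _ hi => ?_
    have : c i = 0 := by
      by_contra hne
      exact hi (Finset.mem_coe.1 (hJ ▸ hne))
    simp [this]
  rcases Nat.lt_or_ge (Function.support c).ncard 2 with h2 | h2
  · obtain ⟨i, hi⟩ := Set.ncard_eq_one.1 (show (Function.support c).ncard = 1 by omega)
    have := hsum' {i} (by simp [hi])
    rw [Finset.sum_singleton, smul_eq_zero] at this
    have hci : i ∈ Function.support c := by rw [hi]; rfl
    exact this.elim hci (h.ne_zero i)
  · obtain ⟨i, j, hij, hs⟩ := Set.ncard_eq_two.1 (show (Function.support c).ncard = 2 by omega)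
    have := hsum' {i, j} (by simp [hs])
    rw [Finset.sum_pair hij] at this
    have hci : i ∈ Function.support c := by rw [hs]; simp
    exact hci (h.eq_zero_of_pair hij this).1

/-- Four vectors together with a vector in the span of the first three of them. -/
def configVectors {R : Type*} [CommRing R] (b : Fin 4 → Fin 4 → R) (a : R) :
    Fin 5 → Fin 4 → R :=
  ![b 0, b 1, b 2, b 3, b 0 + b 1 + a • b 2]

/-- Expanding the fifth vector in the basis shows that all relations are multiples of `(1, 1, a, 0,
-1)`. Distinctness and collinearity of the points are read off from this vector. -/
theorem configVectors_relation {b : Fin 4 → Fin 4 → K} (hb : LinearIndependent K b) {a : K}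
    {c : Fin 5 → K} (hc : ∑ i, c i • configVectors b a i = 0) :
    c 0 = -c 4 ∧ c 1 = -c 4 ∧ c 2 = -(a * c 4) ∧ c 3 = 0 := by
  have h := Fintype.linearIndependent_iff.1 hb ![c 0 + c 4, c 1 + c 4, c 2 + a * c 4, c 3] (by
    rw [← hc]
    simp only [configVectors, Fin.sum_univ_succ]
    simp
    module)
  have h0 := h 0
  have h1 := h 1
  have h2 := h 2
  have h3 := h 3
  simp only [Matrix.cons_val] at h0 h1 h2 h3
  exact ⟨by linear_combination h0, by linear_combination h1, by linear_combination h2, h3⟩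

theorem configVectors_pair {b : Fin 4 → Fin 4 → K} (hb : LinearIndependent K b) (a : K)
    {i j : Fin 5} (hij : i ≠ j) :
    LinearIndependent K ![configVectors b a i, configVectors b a j] := by
  rw [LinearIndependent.pair_iff]
  intro s t hst
  have := configVectors_relation hb (a := a)
    (c := fun k => if k = i then s else if k = j then t else 0) (by
      rw [← hst, Finset.sum_eq_add i j hij]
      · simp [hij.symm]
      · intro k _ hk
        simp [hk.1, hk.2]
      · simp
      · simp)
  fin_cases i <;> fin_cases j <;> simp at hij this ⊢ <;> simp_all

theorem exists_represents_configVectors {b : Fin 4 → Fin 4 → K} (hb : LinearIndependent K b)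
    (a : K) : ∃ p : OrderedPoints K 3 5, p.Represents (configVectors b a) := by
  refine OrderedPoints.exists_represents (fun i j => configVectors_pair hb a) fun i => ?_
  obtain ⟨j, hj⟩ := exists_ne i
  exact (configVectors_pair hb a hj.symm).ne_zero 0

theorem span_configVectors {b : Fin 4 → Fin 4 → K} (hb : LinearIndependent K b) (a : K) :
    Submodule.span K (Set.range (configVectors b a)) = ⊤ := by
  rw [eq_top_iff, ← hb.span_eq_top_of_card_eq_finrank (by simp)]
  refine Submodule.span_mono ?_
  rintro _ ⟨i, rfl⟩
  refine ⟨i.castSucc, ?_⟩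
  fin_cases i <;> rfl

theorem hasRelation_configVectors (b : Fin 4 → Fin 4 → K) (a : K) :
    HasRelation (K := K) (configVectors b a) 4 := by
  refine ⟨![1, 1, a, 0, -1], fun h => by simpa using congrFun h 0, ?_, ?_⟩
  · simp [configVectors, Fin.sum_univ_succ]
  · have : Function.support ![1, 1, a, 0, -1] ⊆ (({0, 1, 2, 4} : Finset (Fin 5)) : Set (Fin 5)) := by
      intro i hi
      fin_cases i <;> simp at hi ⊢
    refine (Set.ncard_le_ncard this (Finset.finite_toSet _)).trans ?_
    rw [Set.ncard_coe_finset]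
    decide

theorem hasRelation_three_configVectors_iff {b : Fin 4 → Fin 4 → K} (hb : LinearIndependent K b)
    (a : K) : HasRelation (K := K) (configVectors b a) 3 ↔ a = 0 := by
  constructor
  · rintro ⟨c, hc, hsum, hcard⟩
    by_contra ha
    obtain ⟨h0, h1, h2, h3⟩ := configVectors_relation hb hsum
    have h4 : c 4 ≠ 0 := by
      intro h4
      apply hc
      ext i
      fin_cases i <;> simp [h0, h1, h2, h3, h4]
    have : (({0, 1, 2, 4} : Finset (Fin 5)) : Set (Fin 5)) ⊆ Function.support c := by
      intro i hi
      simp only [Finset.coe_insert, Finset.coe_singleton, Set.mem_insert_iff,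
        Set.mem_singleton_iff] at hi
      rcases hi with rfl | rfl | rfl | rfl <;> simp [h0, h1, h2, h4, ha]
    have h5 := (Set.ncard_le_ncard this (Set.toFinite _)).trans hcard
    rw [Set.ncard_coe_finset] at h5
    revert h5
    decide
  · rintro rfl
    refine ⟨![1, 1, 0, 0, -1], fun h => by simpa using congrFun h 0, ?_, ?_⟩
    · simp [configVectors, Fin.sum_univ_succ]
    · have : Function.support ![(1 : K), 1, 0, 0, -1] ⊆
          (({0, 1, 4} : Finset (Fin 5)) : Set (Fin 5)) := by
        intro i hi
        fin_cases i <;> simp at hi ⊢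
      refine (Set.ncard_le_ncard this (Finset.finite_toSet _)).trans ?_
      rw [Set.ncard_coe_finset]
      decide

/-- The relation has at least three and at most four nonzero coefficients. Rescaling the vectors
absorbs the values of these coefficients, so only whether there are three or four of them remains
visible, as `a = 0` or `a = 1`. -/
theorem exists_configVectors {p : OrderedPoints K 3 5} {v : Fin 5 → Fin 4 → K}
    (h : p.Represents v) (hspan : Submodule.span K (Set.range v) = ⊤)
    (hrel : HasRelation (K := K) v 4) :
    ∃ (σ : Equiv.Perm (Fin 5)) (b : Fin 4 → Fin 4 → K) (a : K), LinearIndependent K b ∧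
      (a = 0 ∨ a = 1) ∧ (σ • p).Represents (configVectors b a) := by
  classical
  obtain ⟨c, hc, hsum, hcard⟩ := hrel
  have h3 := h.three_le_ncard_support hc hsum
  obtain ⟨l, hl⟩ : ∃ l, c l = 0 := by
    by_contra! hne
    have : Function.support c = Set.univ := Set.eq_univ_of_forall hne
    rw [this, Set.ncard_univ, Nat.card_eq_fintype_card, Fintype.card_fin] at hcard
    omega
  obtain ⟨i, hi, j, hj, k, hk, hij, hik, hjk⟩ := (Set.two_lt_ncard (Set.toFinite _)).1 h3
  rw [Function.mem_support] at hi hj hk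
  have hil : i ≠ l := by rintro rfl; exact hi hl
  have hjl : j ≠ l := by rintro rfl; exact hj hl
  have hkl : k ≠ l := by rintro rfl; exact hk hl
  -- The permutation puts three nonzero coefficients at positions `0, 1, 4` and a zero coefficient
  -- at position `3`. The coefficient left for position `2` is unrestricted and decides `a`.
  let e₁ : Fin 4 ↪ Fin 5 := ⟨![0, 1, 3, 4], by decide⟩
  let e₂ : Fin 4 ↪ Fin 5 := ⟨![i, j, l, k], by
    intro s t hst
    fin_cases s <;> fin_cases t <;> simp_all [eq_comm]⟩
  have := Equiv.Perm.isMultiplyPretransitive (Fin 5) 4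
  obtain ⟨σ, hσ⟩ := MulAction.exists_smul_eq (Equiv.Perm (Fin 5)) e₁ e₂
  have h0 : σ 0 = i := congrArg (fun e : Fin 4 ↪ Fin 5 => e 0) hσ
  have h1 : σ 1 = j := congrArg (fun e : Fin 4 ↪ Fin 5 => e 1) hσ
  have h3 : σ 3 = l := congrArg (fun e : Fin 4 ↪ Fin 5 => e 2) hσ
  have h4 : σ 4 = k := congrArg (fun e : Fin 4 ↪ Fin 5 => e 3) hσ
  subst h0 h1 h3 h4
  have hsum' : ∑ i, c (σ i) • v (σ i) = 0 := by
    rw [← hsum]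
    exact Equiv.sum_comp σ fun i => c i • v i
  simp only [Fin.sum_univ_five, hl, zero_smul, add_zero] at hsum'
  let a : K := if c (σ 2) = 0 then 0 else 1
  -- Solving the relation for the fifth vector gives the coefficients `-(c i / c 4)`, which are
  -- moved into the basis vectors. If the coefficient at position `2` vanishes, that vector is left
  -- unscaled.
  let u : Fin 5 → Kˣ := ![-(Units.mk0 _ hi / Units.mk0 _ hk), -(Units.mk0 _ hj / Units.mk0 _ hk),
    if h : c (σ 2) = 0 then 1 else -(Units.mk0 _ h / Units.mk0 _ hk), 1, 1]
  let b : Fin 4 → Fin 4 → K := fun i => u i.castSucc • v (σ i.castSucc)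
  have hv : (fun i => u i • v (σ i)) = configVectors b a := by
    funext i
    have key : v (σ 4) = -(c (σ 0) / c (σ 4)) • v (σ 0) + -(c (σ 1) / c (σ 4)) • v (σ 1) +
        -(c (σ 2) / c (σ 4)) • v (σ 2) := by
      apply smul_right_injective _ hk
      simp only [smul_add, smul_smul, mul_neg, mul_div_cancel₀ _ hk]
      rw [← sub_eq_zero, ← hsum']
      module
    fin_cases i
    · rfl
    · rfl
    · rfl
    · rfl
    · simp only [configVectors, b, u, a]
      by_cases hz : c (σ 2) = 0
      · simp [hz, key, Units.smul_def]
      · simp [hz, key, Units.smul_def]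
  have hrep : (σ⁻¹ • p).Represents (configVectors b a) := hv ▸ (h.perm σ).smul u
  refine ⟨σ⁻¹, b, a, ?_, ?_, hrep⟩
  · apply linearIndependent_of_top_le_span_of_card_eq_finrank _ (by simp)
    rw [← forgetOrder_spans_iff h, forgetOrder_eq_iff.2 ⟨σ⁻¹, rfl⟩,
      forgetOrder_spans_iff hrep] at hspan
    rw [← hspan, Submodule.span_le]
    have hm : ∀ i, b i ∈ Submodule.span K (Set.range b) := fun i => Submodule.subset_span ⟨i, rfl⟩
    rintro _ ⟨i, rfl⟩
    fin_cases i
    · exact hm 0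
    · exact hm 1
    · exact hm 2
    · exact hm 3
    · exact add_mem (add_mem (hm 0) (hm 1)) (Submodule.smul_mem _ _ (hm 2))
  · by_cases hz : c (σ 2) = 0
    · exact Or.inl (by simp [a, hz])
    · exact Or.inr (by simp [a, hz])

/-- The linear map taking `b` to `b'` also matches the fifth vectors, whose coefficients `1, 1, a`
are the same in both bases. -/
theorem exists_translate_configVectors {b b' : Fin 4 → Fin 4 → K} (hb : LinearIndependent K b)
    (hb' : LinearIndependent K b') {a : K} {p p' : OrderedPoints K 3 5}
    (h : p.Represents (configVectors b a)) (h' : p'.Represents (configVectors b' a)) :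
    ∃ g : Matrix.ProjGenLinGroup (Fin (3 + 1)) K, p.translate g = p' := by
  let B := basisOfLinearIndependentOfCardEqFinrank hb (by simp)
  let B' := basisOfLinearIndependentOfCardEqFinrank hb' (by simp)
  let e : (Fin 4 → K) ≃ₗ[K] (Fin 4 → K) := B.equiv B' (Equiv.refl _)
  have he : ∀ i, e (b i) = b' i := fun i => by
    have := B.equiv_apply (b' := B') i (Equiv.refl _)
    simpa [B, B'] using this
  let g : GL (Fin (3 + 1)) K := Matrix.GeneralLinearGroup.toLin.symm
    (LinearMap.GeneralLinearGroup.ofLinearEquiv e)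
  have hg : ∀ v, g.1.mulVec v = e v := by
    intro v
    have : g.1 = LinearMap.toMatrix' (e : (Fin 4 → K) →ₗ[K] (Fin 4 → K)) := rfl
    rw [this, ← Matrix.toLin'_apply, Matrix.toLin'_toMatrix']
    rfl
  refine ⟨.mk g, (h.translate g).eq_of_represents ?_⟩
  have : (fun i => g.1.mulVec (configVectors b a i)) = configVectors b' a := by
    funext i
    rw [hg]
    fin_cases i <;> simp [configVectors, he]
  rwa [this]

theorem HasRelation.mulVec {v : Fin 5 → Fin 4 → K} {m : ℕ}
    (hr : HasRelation (K := K) v m) (g : GL (Fin 4) K) :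
    HasRelation (K := K) (fun i => g.1.mulVec (v i)) m := by
  obtain ⟨c, hc, hsum, hcard⟩ := hr
  refine ⟨c, hc, ?_, hcard⟩
  have := congrArg g.1.mulVecLin hsum
  simpa [map_sum] using this

end NormalForm

/-! ### Cubic forms and their directional derivatives -/

section Cubic

open MvPolynomial

variable {K : Type*} [Field K] {n : ℕ}

theorem Finsupp.exists_add_single_of_degree_eq_succ {σ : Type*} {m : σ →₀ ℕ} {d : ℕ}
    (h : m.degree = d + 1) : ∃ i m', m = m' + Finsupp.single i 1 ∧ m'.degree = d := by
  have hne : m ≠ 0 := by rintro rfl; simp at h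
  obtain ⟨i, hi⟩ := Finsupp.ne_iff.1 hne
  have hle : Finsupp.single i 1 ≤ m := by
    rw [Finsupp.single_le_iff]
    exact Nat.one_le_iff_ne_zero.2 hi
  refine ⟨i, m - Finsupp.single i 1, (tsub_add_cancel_of_le hle).symm, ?_⟩
  have := congrArg Finsupp.degree (tsub_add_cancel_of_le hle)
  rw [map_add, Finsupp.degree_single, h] at this
  omega

theorem MvPolynomial.IsHomogeneous.cubic_induction {σ : Type*} {P : MvPolynomial σ K → Prop}
    (hadd : ∀ F G, P F → P G → P (F + G)) (hmon : ∀ c i j k, P (C c * (X i * X j * X k)))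
    {F : MvPolynomial σ K} (hF : F.IsHomogeneous 3) (h0 : P 0) : P F := by
  rw [F.as_sum]
  refine Finset.sum_induction _ P hadd h0 fun m hm => ?_
  have hdeg : m.degree = 3 := by
    have := hF (mem_support_iff.1 hm)
    rwa [Finsupp.degree_eq_weight_one]
  obtain ⟨i, m₁, rfl, h1⟩ := Finsupp.exists_add_single_of_degree_eq_succ hdeg
  obtain ⟨j, m₂, rfl, h2⟩ := Finsupp.exists_add_single_of_degree_eq_succ h1
  obtain ⟨k, m₃, rfl, h3⟩ := Finsupp.exists_add_single_of_degree_eq_succ h2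
  rw [Finsupp.degree_eq_zero_iff] at h3
  subst h3
  have : ∀ a : K, monomial (0 + Finsupp.single k 1 + Finsupp.single j 1 + Finsupp.single i 1) a =
      C a * (X k * X j * X i) := by
    intro a
    rw [zero_add, X, X, X, C_apply, monomial_mul, monomial_mul, monomial_mul]
    simp
  rw [this]
  exact hmon _ _ _ _

/-- The derivative of a polynomial in the direction `u`. -/
noncomputable def dirDeriv {σ : Type*} (u : σ → K) :
    Derivation K (MvPolynomial σ K) (MvPolynomial σ K) :=
  mkDerivation K fun j => C (u j)

@[simp]
theorem dirDeriv_X {σ : Type*} (u : σ → K) (j : σ) : dirDeriv u (X j) = C (u j) := by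
  simp [dirDeriv, mkDerivation_X]

@[simp]
theorem dirDeriv_C {σ : Type*} (u : σ → K) (a : K) : dirDeriv u (C a) = 0 := by
  simp [dirDeriv]

theorem eval_dirDeriv_mul {σ : Type*} (u v : σ → K) (F G : MvPolynomial σ K) :
    eval v (dirDeriv u (F * G)) =
      eval v F * eval v (dirDeriv u G) + eval v G * eval v (dirDeriv u F) := by
  simp [Derivation.leibniz]

/-- This is a cubic restricted to a line, with both mixed coefficients written as first derivatives,
one at each end. A cubic singular at both ends therefore vanishes on the line. Both sides are
additive in `F`, so monomials suffice. -/
theorem MvPolynomial.IsHomogeneous.eval_cubic_add {σ : Type*} {F : MvPolynomial σ K}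
    (hF : F.IsHomogeneous 3) (u w : σ → K) (s t : K) :
    eval (s • u + t • w) F = s ^ 3 * eval u F + s ^ 2 * t * eval u (dirDeriv w F) +
      s * t ^ 2 * eval w (dirDeriv u F) + t ^ 3 * eval w F := by
  refine hF.cubic_induction (P := fun F => eval (s • u + t • w) F = s ^ 3 * eval u F +
    s ^ 2 * t * eval u (dirDeriv w F) + s * t ^ 2 * eval w (dirDeriv u F) + t ^ 3 * eval w F)
    ?_ ?_ ?_
  · intro F G h1 h2
    simp only [map_add, h1, h2]
    ring
  · intro c i j k
    simp only [eval_dirDeriv_mul, dirDeriv_X, dirDeriv_C, map_mul, eval_C, eval_X, Pi.add_apply,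
      Pi.smul_apply, smul_eq_mul, map_zero]
    ring
  · simp

/-- The values of a cubic form singular at four points on the span of these points. -/
theorem MvPolynomial.IsHomogeneous.exists_eval_cubic {σ : Type*} {F : MvPolynomial σ K}
    (hF : F.IsHomogeneous 3) (b : Fin 4 → σ → K) : ∃ A : Fin 4 → K, ∀ y : Fin 4 → K,
    eval (∑ i, y i • b i) F = (∑ i, y i ^ 3 * eval (b i) F) +
      (∑ i, ∑ j, if i = j then 0 else y i ^ 2 * y j * eval (b i) (dirDeriv (b j) F)) +
      (A 0 * (y 1 * y 2 * y 3) + A 1 * (y 0 * y 2 * y 3) + A 2 * (y 0 * y 1 * y 3) +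
        A 3 * (y 0 * y 1 * y 2)) := by
  refine hF.cubic_induction (P := fun F => ∃ A : Fin 4 → K, ∀ y : Fin 4 → K,
    eval (∑ i, y i • b i) F = (∑ i, y i ^ 3 * eval (b i) F) +
      (∑ i, ∑ j, if i = j then 0 else y i ^ 2 * y j * eval (b i) (dirDeriv (b j) F)) +
      (A 0 * (y 1 * y 2 * y 3) + A 1 * (y 0 * y 2 * y 3) + A 2 * (y 0 * y 1 * y 3) +
        A 3 * (y 0 * y 1 * y 2))) ?_ ?_ ?_
  · rintro F G ⟨A, hA⟩ ⟨B, hB⟩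
    refine ⟨A + B, fun y => ?_⟩
    simp only [map_add, hA, hB]
    simp [Fin.sum_univ_four]
    ring
  · intro c i j k
    -- The coefficient of `y p * y q * y r` in the product of three linear forms is the sum over the
    -- six ways of distributing the indices.
    let s : Fin 4 → Fin 4 → Fin 4 → K := fun p q r =>
      c * (b p i * b q j * b r k + b p i * b r j * b q k + b q i * b p j * b r k +
        b q i * b r j * b p k + b r i * b p j * b q k + b r i * b q j * b p k)
    refine ⟨![s 1 2 3, s 0 2 3, s 0 1 3, s 0 1 2], fun y => ?_⟩
    simp only [eval_dirDeriv_mul, dirDeriv_X, dirDeriv_C, map_mul, eval_C, eval_X, Pi.add_apply,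
      Pi.smul_apply, smul_eq_mul, map_zero, Fin.sum_univ_four, Fin.isValue, s, Matrix.cons_val,
      reduceIte, Fin.reduceEq]
    ring
  · exact ⟨0, fun y => by simp⟩

/-- A cubic form of `ℙ³` that is singular at five points vanishes unless four of the points are
coplanar. -/
theorem hasRelation_of_singular_cubic [CharZero K] {v : Fin 5 → Fin 4 → K}
    {F : MvPolynomial (Fin 4) K} (hF : F.IsHomogeneous 3) (hF0 : F ≠ 0)
    (h0 : ∀ i, eval (v i) F = 0) (h1 : ∀ i u, eval (v i) (dirDeriv u F) = 0) :
    HasRelation (K := K) v 4 := by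
  by_contra hno
  -- Without a relation on four vectors, every nontrivial relation involves all five. Hence the
  -- first four form a basis in which the fifth has only nonzero coordinates.
  have hc : ∀ c : Fin 5 → K, c ≠ 0 → ∑ i, c i • v i = 0 → ∀ i, c i ≠ 0 := by
    intro c hc hsum i hi
    refine hno ⟨c, hc, hsum, ?_⟩
    have : Function.support c ⊆ ((Finset.univ.erase i : Finset (Fin 5)) : Set (Fin 5)) := by
      intro j hj
      simp only [Finset.coe_erase, Finset.coe_univ, Set.mem_sdiff, Set.mem_univ, true_and,
        Set.mem_singleton_iff]
      rintro rfl
      exact hj hi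
    refine (Set.ncard_le_ncard this (Finset.finite_toSet _)).trans ?_
    rw [Set.ncard_coe_finset, Finset.card_erase_of_mem (Finset.mem_univ _)]
    simp
  obtain ⟨c, hsum, i₀, hi₀⟩ : ∃ c : Fin 5 → K, ∑ i, c i • v i = 0 ∧ ∃ i, c i ≠ 0 := by
    apply Fintype.not_linearIndependent_iff.1
    intro hli
    simpa using hli.fintype_card_le_finrank
  have hne := hc c (fun h => hi₀ (congrFun h i₀)) hsum
  let b : Fin 4 → Fin 4 → K := fun i => v i.castSucc
  have hb : LinearIndependent K b := by
    rw [Fintype.linearIndependent_iff]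
    intro g hg
    by_contra! hg'
    obtain ⟨i, hi⟩ := hg'
    refine hc (Fin.snoc (α := fun _ => K) g 0)
      (fun h => hi <| by
        have := congrFun h i.castSucc
        rwa [Fin.snoc_castSucc] at this) ?_ (Fin.last 4)
      (Fin.snoc_last _ _)
    rw [Fin.sum_univ_castSucc]
    simp only [Fin.snoc_castSucc, Fin.snoc_last, zero_smul, add_zero]
    exact hg
  have hspan : ∀ z : Fin 4 → K, ∃ y : Fin 4 → K, ∑ i, y i • b i = z := by
    intro z
    have : z ∈ Submodule.span K (Set.range b) := by
      rw [hb.span_eq_top_of_card_eq_finrank (by simp)]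
      trivial
    exact (Submodule.mem_span_range_iff_exists_fun K).1 this
  obtain ⟨A, hA⟩ := hF.exists_eval_cubic b
  have hA' : ∀ y : Fin 4 → K, eval (∑ i, y i • b i) F =
      (A 0 * (y 1 * y 2 * y 3) + A 1 * (y 0 * y 2 * y 3) + A 2 * (y 0 * y 1 * y 3) +
        A 3 * (y 0 * y 1 * y 2)) := by
    intro y
    rw [hA]
    simp [b, h0, h1]
  let d : Fin 4 → K := fun i => -(c i.castSucc / c 4)
  have hd : ∀ i, d i ≠ 0 := fun i => neg_ne_zero.2 (div_ne_zero (hne _) (hne _))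
  have hv4 : ∑ i, d i • b i = v 4 := by
    apply smul_right_injective _ (hne 4)
    simp only [Finset.smul_sum, smul_smul, d, mul_neg, mul_div_cancel₀ _ (hne 4)]
    rw [Fin.sum_univ_castSucc] at hsum
    rw [← sub_eq_zero, ← neg_eq_zero, ← hsum]
    simp only [neg_smul, Finset.sum_neg_distrib, b]
    rw [show Fin.last 4 = 4 from rfl]
    module
  -- The cubic is singular at the fifth point and at the `j`-th basis point, so it vanishes on the
  -- line joining them.
  have hline : ∀ j, eval (∑ i, (d + Pi.single j 1 : Fin 4 → K) i • b i) F = 0 := by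
    intro j
    have : ∑ i, (d + Pi.single j 1 : Fin 4 → K) i • b i = (1 : K) • v 4 + (1 : K) • b j := by
      simp only [Pi.add_apply, add_smul, Finset.sum_add_distrib, hv4, one_smul]
      congr 1
      rw [Finset.sum_eq_single j] <;> simp +contextual
    rw [this, hF.eval_cubic_add]
    simp [b, h0, h1]
  have hbase : eval (∑ i, d i • b i) F = 0 := by rw [hv4, h0]
  rw [hA'] at hbase
  have e0 := hline 0
  have e1 := hline 1
  have e2 := hline 2
  have e3 := hline 3
  rw [hA'] at e0 e1 e2 e3
  simp at e0 e1 e2 e3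
  -- Let `B i` be the product of `A i` and the three `d j` with `j ≠ i`. The cubic is affine in each
  -- coordinate, so `d j * (e j - hbase)` says that the sum of the `B i` over `i ≠ j` vanishes.
  -- Adding the three equations with `j ≠ 0` and subtracting twice the one with `j = 0` leaves `3 *
  -- B 0`.
  have q0 : (A 0 * (d 1 * d 2 * d 3)) * 3 = 0 := by
    linear_combination (-2 * d 0) * (e0 - hbase) + d 1 * (e1 - hbase) + d 2 * (e2 - hbase) +
      d 3 * (e3 - hbase)
  have q1 : (A 1 * (d 0 * d 2 * d 3)) * 3 = 0 := by
    linear_combination (-2 * d 1) * (e1 - hbase) + d 0 * (e0 - hbase) + d 2 * (e2 - hbase) +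
      d 3 * (e3 - hbase)
  have q2 : (A 2 * (d 0 * d 1 * d 3)) * 3 = 0 := by
    linear_combination (-2 * d 2) * (e2 - hbase) + d 1 * (e1 - hbase) + d 0 * (e0 - hbase) +
      d 3 * (e3 - hbase)
  have q3 : (A 3 * (d 0 * d 1 * d 2)) * 3 = 0 := by
    linear_combination (-2 * d 3) * (e3 - hbase) + d 1 * (e1 - hbase) + d 2 * (e2 - hbase) +
      d 0 * (e0 - hbase)
  simp only [mul_eq_zero, hd, or_false, OfNat.ofNat_ne_zero] at q0 q1 q2 q3
  apply hF0
  apply MvPolynomial.funext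
  intro z
  obtain ⟨y, rfl⟩ := hspan z
  rw [hA', q0, q1, q2, q3]
  simp

end Cubic

/-! ### Double points and the cohomology of their ideal sheaf -/

section DoublePoints

open MvPolynomial

variable {K : Type*} [Field K] {n x : ℕ}

theorem mem_pointIdeal_mk {v : Fin (n + 1) → K} (hv : v ≠ 0)
    {F : MvPolynomial (Fin (n + 1)) K} :
    F ∈ pointIdeal (Projectivization.mk K v hv) ↔ ∀ c : K, eval (c • v) F = 0 := by
  unfold pointIdeal
  rw [mem_vanishingIdeal_iff, Projectivization.submodule_mk]
  simp only [SetLike.mem_coe, Submodule.mem_span_singleton, forall_exists_index,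
    forall_apply_eq_imp_iff]
  rfl

theorem singular_of_mem_pointIdeal_sq {v : Fin (n + 1) → K} (hv : v ≠ 0)
    {F : MvPolynomial (Fin (n + 1)) K} (hF : F ∈ pointIdeal (Projectivization.mk K v hv) ^ 2) :
    eval v F = 0 ∧ ∀ u, eval v (dirDeriv u F) = 0 := by
  have hz : ∀ a ∈ pointIdeal (Projectivization.mk K v hv), eval v a = 0 := fun a ha => by
    simpa using (mem_pointIdeal_mk hv).1 ha 1
  rw [pow_two] at hF
  refine Submodule.mul_induction_on hF ?_ ?_
  · intro a ha b hb
    exact ⟨by simp [hz a ha], fun u => by simp [hz a ha, hz b hb]⟩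
  · rintro a b ⟨ha, ha'⟩ ⟨hb, hb'⟩
    exact ⟨by simp [ha, hb], fun u => by simp [ha', hb']⟩

/-- By the Leibniz rule a factor that does not vanish at the point can be cancelled. The factors in
question are powers of coordinates coming from Čech denominators. -/
theorem singular_of_mul_mem_pointIdeal_sq {v : Fin (n + 1) → K} (hv : v ≠ 0)
    {F G : MvPolynomial (Fin (n + 1)) K} (hG : eval v G ≠ 0)
    (hF : G * F ∈ pointIdeal (Projectivization.mk K v hv) ^ 2) :
    eval v F = 0 ∧ ∀ u, eval v (dirDeriv u F) = 0 := by
  obtain ⟨h0, h1⟩ := singular_of_mem_pointIdeal_sq hv hF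
  rw [map_mul, mul_eq_zero, or_iff_right hG] at h0
  refine ⟨h0, fun u => ?_⟩
  have := h1 u
  rwa [eval_dirDeriv_mul, h0, zero_mul, add_zero, mul_eq_zero, or_iff_right hG] at this

theorem mem_doublePointsIdeal {p : OrderedPoints K n x} {F : MvPolynomial (Fin (n + 1)) K} :
    F ∈ doublePointsIdeal (forgetOrder K n x p) ↔ ∀ i, F ∈ pointIdeal (p.point i) ^ 2 := by
  unfold doublePointsIdeal
  simp only [Submodule.mem_iInf, mem_forgetOrder, forall_exists_index, forall_apply_eq_imp_iff]

/-- The linear form with coefficients `l`. -/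
noncomputable def linForm (l : Fin (n + 1) → K) : MvPolynomial (Fin (n + 1)) K :=
  ∑ j, C (l j) * X j

theorem eval_linForm (l v : Fin (n + 1) → K) : eval v (linForm l) = l ⬝ᵥ v := by
  simp [linForm, dotProduct]

theorem eval_dirDeriv_linForm (l u v : Fin (n + 1) → K) :
    eval v (dirDeriv u (linForm l)) = l ⬝ᵥ u := by
  simp [linForm, dotProduct, map_sum]

theorem isHomogeneous_linForm (l : Fin (n + 1) → K) : (linForm l).IsHomogeneous 1 :=
  IsHomogeneous.sum _ _ _ fun j _ => by
    simpa using (isHomogeneous_C _ (l j)).mul (isHomogeneous_X K j)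

theorem linForm_ne_zero {l : Fin (n + 1) → K} (hl : l ≠ 0) : linForm l ≠ 0 := by
  intro h
  apply hl
  ext j
  have := eval_linForm l (Pi.single j 1)
  simpa [h] using this.symm

theorem linForm_mem_pointIdeal {l v : Fin (n + 1) → K} (hv : v ≠ 0) (h : l ⬝ᵥ v = 0) :
    linForm l ∈ pointIdeal (Projectivization.mk K v hv) := by
  rw [mem_pointIdeal_mk]
  intro c
  rw [eval_linForm, dotProduct_smul, h, smul_zero]

theorem exists_dotProduct_of_linearMap (f : (Fin (n + 1) → K) →ₗ[K] K) :
    ∃ l : Fin (n + 1) → K, ∀ v, l ⬝ᵥ v = f v := by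
  refine ⟨fun j => f (Pi.single j 1), fun v => ?_⟩
  conv_rhs => rw [pi_eq_sum_univ' v]
  simp [dotProduct, map_sum, mul_comm]

theorem exists_dotProduct_eq_zero (W : Submodule K (Fin (n + 1) → K)) (hW : W ≠ ⊤) :
    ∃ l : Fin (n + 1) → K, l ≠ 0 ∧ ∀ v ∈ W, l ⬝ᵥ v = 0 := by
  obtain ⟨f, hf, hW⟩ := Submodule.exists_le_ker_of_lt_top W hW.lt_top
  obtain ⟨l, hl⟩ := exists_dotProduct_of_linearMap f
  refine ⟨l, ?_, fun v hv => by rw [hl]; exact hW hv⟩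
  rintro rfl
  exact hf (LinearMap.ext fun v => by rw [← hl]; simp)

theorem exists_dotProduct_of_pair {u v : Fin (n + 1) → K} (h : LinearIndependent K ![u, v]) :
    ∃ l : Fin (n + 1) → K, l ⬝ᵥ u = 0 ∧ l ⬝ᵥ v ≠ 0 := by
  have hv : v ∉ Submodule.span K {u} := by
    rw [Submodule.mem_span_singleton]
    rintro ⟨a, ha⟩
    exact (LinearIndependent.pair_iff' (h.ne_zero 0)).1 h a ha
  obtain ⟨f, hf, hW⟩ := Submodule.exists_le_ker_of_notMem hv
  obtain ⟨l, hl⟩ := exists_dotProduct_of_linearMap f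
  refine ⟨l, ?_, by rwa [hl]⟩
  rw [hl]
  exact hW (Submodule.mem_span_singleton_self u)

end DoublePoints

/-! ### Čech cohomology in degrees 0 and 1. -/

section Cech

open MvPolynomial

variable {K : Type*} [Field K] {n x : ℕ}

theorem twistedSections_mono {I J : Ideal (MvPolynomial (Fin (n + 1)) K)} (h : I ≤ J) (d : ℕ)
    (T : Finset (Fin (n + 1))) : twistedSections I d T ≤ twistedSections J d T := by
  rintro s ⟨N, a, ha, ha', hs⟩
  exact ⟨N, a, h ha, ha', hs⟩

theorem MvPolynomial.IsHomogeneous.of_X_pow_mul {σ : Type*} {F : MvPolynomial σ K} {i : σ}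
    {N d : ℕ} (h : (X i ^ N * F).IsHomogeneous (d + N)) : F.IsHomogeneous d := by
  intro m hm
  have h1 : coeff (Finsupp.single i N + m) (X i ^ N * F) ≠ 0 := by
    rw [X_pow_eq_monomial, coeff_monomial_mul, one_mul]
    exact hm
  have h2 := h h1
  have e : ∀ m : σ →₀ ℕ, Finsupp.weight 1 m = m.degree := fun m => by
    rw [Finsupp.degree_eq_weight_one]
    rfl
  rw [e] at h2 ⊢
  rw [map_add, Finsupp.degree_single] at h2
  omega

/-- A family of sections over the standard affine charts that agree in the fraction field is
given by a form. -/
theorem exists_form_of_mem_twistedSections {I : Ideal (MvPolynomial (Fin (n + 1)) K)} {d : ℕ}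
    (hn : 1 ≤ n) {s : FractionRing (MvPolynomial (Fin (n + 1)) K)}
    (hs : ∀ i, s ∈ twistedSections I d {i}) :
    ∃ F : MvPolynomial (Fin (n + 1)) K, F.IsHomogeneous d ∧ algebraMap _ _ F = s ∧
      ∀ i, ∃ N, X i ^ N * F ∈ I := by
  set ι := algebraMap (MvPolynomial (Fin (n + 1)) K)
    (FractionRing (MvPolynomial (Fin (n + 1)) K)) with hι
  have hinj : Function.Injective ι := IsFractionRing.injective _ _
  have hs' : ∀ i, ∃ N a, a ∈ I ∧ a.IsHomogeneous (d + N) ∧ s * ι (X i) ^ N = ι a := by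
    intro i
    obtain ⟨N, a, ha, ha', h⟩ := hs i
    exact ⟨N, a, ha, by simpa using ha', by simpa using h⟩
  obtain ⟨i, j, hij⟩ : ∃ i j : Fin (n + 1), i ≠ j :=
    ⟨0, Fin.last n, by rw [Ne, Fin.ext_iff]; simp; omega⟩
  obtain ⟨N, a, -, ha', h⟩ := hs' i
  obtain ⟨M, b, -, -, hb⟩ := hs' j
  -- Two charts suffice to remove all denominators: `X i` is prime and does not divide `X j ^ M`, so
  -- `X i ^ N` divides `a`.
  have heq : X j ^ M * a = X i ^ N * b := by
    apply hinj
    simp only [map_mul, map_pow, ← h, ← hb]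
    ring
  have hnd : ¬ (X i : MvPolynomial (Fin (n + 1)) K) ∣ X j ^ M := by
    intro hd
    have := (X_prime (R := K) (i := i)).dvd_of_dvd_pow hd
    rw [X_dvd_X] at this
    exact hij this
  obtain ⟨F, rfl⟩ := (X_prime (R := K) (i := i)).pow_dvd_of_dvd_mul_left N hnd ⟨b, heq⟩
  have hF : ι F = s := by
    have h0 : ι (X i) ^ N ≠ 0 := by
      rw [← map_pow]
      exact (map_ne_zero_iff _ hinj).2 (pow_ne_zero _ (X_ne_zero i))
    apply mul_right_cancel₀ h0
    rw [h, map_mul, map_pow, mul_comm]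
  refine ⟨F, ha'.of_X_pow_mul, hF, fun k => ?_⟩
  obtain ⟨L, e, he, -, h'⟩ := hs' k
  refine ⟨L, ?_⟩
  have : X k ^ L * F = e := by
    apply hinj
    rw [← h', ← hF, map_mul, map_pow, mul_comm]
  rwa [this]

theorem cechDifferential_apply (q : ℕ) (c : (Fin (q + 1) → Fin (n + 1)) →
    FractionRing (MvPolynomial (Fin (n + 1)) K)) (σ : Fin (q + 2) → Fin (n + 1)) :
    cechDifferential K n q c σ = ∑ k : Fin (q + 2), (-1 : K) ^ (k : ℕ) • c (σ ∘ k.succAbove) := by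
  simp [cechDifferential, LinearMap.sum_apply, LinearMap.funLeft_apply]

theorem cechDifferential_zero_apply (c : (Fin 1 → Fin (n + 1)) →
    FractionRing (MvPolynomial (Fin (n + 1)) K)) (σ : Fin 2 → Fin (n + 1)) :
    cechDifferential K n 0 c σ = c (fun _ => σ 1) - c (fun _ => σ 0) := by
  rw [cechDifferential_apply]
  refine (Fin.sum_univ_two _).trans ?_
  have e0 : (σ ∘ (0 : Fin 2).succAbove : Fin 1 → Fin (n + 1)) = fun _ => σ 1 := by
    funext k; fin_cases k; rfl
  have e1 : (σ ∘ (1 : Fin 2).succAbove : Fin 1 → Fin (n + 1)) = fun _ => σ 0 := by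
    funext k; fin_cases k; rfl
  rw [e0, e1]
  simp [sub_eq_add_neg]

theorem cechDifferential_one_apply (c : (Fin 2 → Fin (n + 1)) →
    FractionRing (MvPolynomial (Fin (n + 1)) K)) (σ : Fin 3 → Fin (n + 1)) :
    cechDifferential K n 1 c σ = c ![σ 1, σ 2] - c ![σ 0, σ 2] + c ![σ 0, σ 1] := by
  rw [cechDifferential_apply]
  refine (Fin.sum_univ_three _).trans ?_
  have e0 : (σ ∘ (0 : Fin 3).succAbove : Fin 2 → Fin (n + 1)) = ![σ 1, σ 2] := by
    funext k; fin_cases k <;> rfl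
  have e1 : (σ ∘ (1 : Fin 3).succAbove : Fin 2 → Fin (n + 1)) = ![σ 0, σ 2] := by
    funext k; fin_cases k <;> rfl
  have e2 : (σ ∘ (2 : Fin 3).succAbove : Fin 2 → Fin (n + 1)) = ![σ 0, σ 1] := by
    funext k; fin_cases k <;> rfl
  rw [e0, e1, e2]
  simp [sub_eq_add_neg]

/-- A 0-cocycle is a single fraction shared by all charts, hence a form. Since `I` need not be
saturated, the form belongs to it only up to powers of the coordinates, which is enough to test
singularity at points. -/
theorem exists_form_of_cohomologyDim_zero_pos {I : Ideal (MvPolynomial (Fin (n + 1)) K)} {d : ℕ}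
    (hn : 1 ≤ n) (h : 0 < cohomologyDim I d 0) :
    ∃ F : MvPolynomial (Fin (n + 1)) K, F.IsHomogeneous d ∧ F ≠ 0 ∧ ∀ i, ∃ N, X i ^ N * F ∈ I := by
  obtain ⟨y, hy⟩ := rank_pos_iff_exists_ne_zero.1 h
  obtain ⟨⟨c, hc⟩, rfl⟩ := Submodule.Quotient.mk_surjective _ y
  have hc0 : c ≠ 0 := by
    rintro rfl
    apply hy
    exact Submodule.Quotient.mk_zero _
  obtain ⟨hc1, hc2⟩ := hc
  have hδ : ∀ i j : Fin (n + 1), c (fun _ => i) = c (fun _ => j) := by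
    intro i j
    have := congrFun hc2 ![j, i]
    rw [cechDifferential_zero_apply] at this
    exact sub_eq_zero.1 this
  obtain ⟨F, hF, hFs, hFI⟩ := exists_form_of_mem_twistedSections (I := I) (d := d) hn
    (s := c fun _ => 0) (by
      intro i
      rw [hδ 0 i]
      have := hc1 (fun _ => i) trivial
      simpa using this)
  refine ⟨F, hF, ?_, hFI⟩
  rintro rfl
  apply hc0
  funext σ
  have : σ = fun _ => σ 0 := by funext k; fin_cases k; rfl
  rw [this, hδ _ 0, ← hFs, map_zero]
  rfl

theorem cohomologyDim_zero_pos {I : Ideal (MvPolynomial (Fin (n + 1)) K)} {d : ℕ}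
    {F : MvPolynomial (Fin (n + 1)) K} (hF : F.IsHomogeneous d) (hF0 : F ≠ 0) (hFI : F ∈ I) :
    0 < cohomologyDim I d 0 := by
  apply rank_pos_iff_exists_ne_zero.2
  have hmem : (fun _ => algebraMap _ _ F) ∈ cechCocycles I d 0 := by
    refine ⟨fun σ _ => ⟨0, F, hFI, by simpa using hF, by simp⟩, ?_⟩
    refine LinearMap.mem_ker.2 (funext fun σ => ?_)
    rw [cechDifferential_zero_apply]
    exact sub_self _
  refine ⟨Submodule.Quotient.mk ⟨_, hmem⟩, ?_⟩
  rw [Ne, Submodule.Quotient.mk_eq_zero]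
  intro h
  have h3 : algebraMap _ (FractionRing (MvPolynomial (Fin (n + 1)) K)) F = 0 :=
    congrFun ((Submodule.mem_bot K).1 (Submodule.mem_comap.1 h)) fun _ => 0
  exact hF0 ((map_eq_zero_iff _ (IsFractionRing.injective _ _)).1 h3)

/-- If local sections `f i` of `𝒪(d)` with `f j - f i` in `ℐ(d)` are not given modulo `ℐ(d)` by a
form of degree `d`, then `h¹(ℐ(d)) > 0`. -/
theorem cohomologyDim_one_pos {I : Ideal (MvPolynomial (Fin (n + 1)) K)} {d : ℕ} (hn : 1 ≤ n)
    (f : Fin (n + 1) → FractionRing (MvPolynomial (Fin (n + 1)) K))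
    (hf : ∀ i, f i ∈ twistedSections ⊤ d {i})
    (hfI : ∀ i j, i ≠ j → f j - f i ∈ twistedSections I d {i, j})
    (hno : ∀ F : MvPolynomial (Fin (n + 1)) K, F.IsHomogeneous d →
      (∀ i, f i - algebraMap _ _ F ∈ twistedSections I d {i}) → False) :
    0 < cohomologyDim I d 1 := by
  apply rank_pos_iff_exists_ne_zero.2
  have hmem : (fun σ : Fin 2 → Fin (n + 1) => f (σ 1) - f (σ 0)) ∈ cechCocycles I d 1 := by
    refine ⟨fun σ _ => ?_, ?_⟩
    · by_cases h : σ 0 = σ 1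
      · simp only [h, sub_self]
        exact zero_mem _
      · have : Finset.univ.image σ = {σ 0, σ 1} := by
          ext i
          simp [Fin.exists_fin_two, eq_comm]
        change f (σ 1) - f (σ 0) ∈ twistedSections I d (Finset.univ.image σ)
        rw [this]
        exact hfI _ _ h
    · refine LinearMap.mem_ker.2 (funext fun σ => ?_)
      rw [cechDifferential_one_apply]
      simp
  refine ⟨Submodule.Quotient.mk ⟨_, hmem⟩, ?_⟩
  rw [Ne, Submodule.Quotient.mk_eq_zero]
  rintro ⟨b, hb, hbf⟩
  have hb' : ∀ i, b (fun _ => i) ∈ twistedSections I d {i} := fun i => by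
    simpa using hb (fun _ => i) trivial
  -- If the class is trivial, correcting `f` by sections `b` of `ℐ(d)` makes the local sections
  -- agree on all charts, and they glue to a form.
  have hconst : ∀ i j, f i - b (fun _ => i) = f j - b (fun _ => j) := by
    intro i j
    have := congrFun hbf ![i, j]
    rw [cechDifferential_zero_apply] at this
    simp only [Matrix.cons_val_zero, Matrix.cons_val_one, Submodule.coe_subtype] at this
    linear_combination this
  obtain ⟨F, hF, hFs, -⟩ := exists_form_of_mem_twistedSections (I := ⊤) (d := d) hn
    (s := f 0 - b fun _ => 0) (by
      intro i
      rw [hconst 0 i]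
      exact sub_mem (hf i) (twistedSections_mono le_top d _ (hb' i)))
  refine hno F hF fun i => ?_
  rw [hFs, hconst 0 i, sub_sub_cancel]
  exact hb' i

end Cech

/-! ### The Terracini locus `𝕋(3, 3; 5)` as a set -/

section TerraciniSet

open MvPolynomial

variable {K : Type*} [Field K]

-- The lines through points `0, 1` and through points `2, 4` meet at `v 0 + v 1`. A cubic singular
-- at `1, 2, 4` and vanishing at `0` is zero there along the second line, while along the first its
-- value is the derivative at `v 0` in the direction `v 1`. Hence a jet with nonzero derivative in
-- that direction, zero value at `v 0` and zero jets at the other points does not come from a cubic.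
-- The proof writes such a jet as local sections of `𝒪(3)`.
set_option maxHeartbeats 1000000 in
theorem OrderedPoints.Represents.cohomologyDim_one_pos {p : OrderedPoints K 3 5}
    {v : Fin 5 → Fin (3 + 1) → K} (h : p.Represents v) {s t : K} (hrel : v 0 + v 1 = s • v 2 + t • v 4) :
    0 < cohomologyDim (doublePointsIdeal (forgetOrder K 3 5 p)) 3 1 := by
  classical
  obtain ⟨w, hw0, hw1⟩ := exists_dotProduct_of_pair (h.linearIndependent_pair zero_ne_one)
  have hl : ∀ j, ∃ l : Fin (3 + 1) → K, j ≠ 0 → l ⬝ᵥ v j = 0 ∧ l ⬝ᵥ v 0 ≠ 0 := by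
    intro j
    by_cases hj : j = 0
    · exact ⟨0, fun h => absurd hj h⟩
    · obtain ⟨l, hl⟩ := exists_dotProduct_of_pair (h.linearIndependent_pair hj)
      exact ⟨l, fun _ => hl⟩
  choose l hl using hl
  -- `g` vanishes doubly at the four other points but not at point `0`; `linForm w` vanishes at
  -- point `0` with nonzero derivative in the direction `v 1`.
  set g : MvPolynomial (Fin (3 + 1)) K := ∏ j ∈ Finset.univ.erase 0, linForm (l j) ^ 2 with hg
  have hg0 : eval (v 0) g ≠ 0 := by
    rw [hg, map_prod, Finset.prod_ne_zero_iff]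
    intro j hj
    rw [map_pow, eval_linForm]
    exact pow_ne_zero _ (hl j (Finset.ne_of_mem_erase hj)).2
  have hgj : ∀ j, j ≠ 0 → g ∈ pointIdeal (p.point j) ^ 2 := by
    intro j hj
    obtain ⟨h0, h1⟩ := h j
    rw [hg, ← Finset.mul_prod_erase _ _ (Finset.mem_erase.2 ⟨hj, Finset.mem_univ j⟩), h1]
    exact Ideal.mul_mem_right _ _ (Ideal.pow_mem_pow (linForm_mem_pointIdeal h0 (hl j hj).1) 2)
  have hghom : g.IsHomogeneous 8 :=
    IsHomogeneous.prod _ _ (fun _ => 1 * 2) fun j _ => (isHomogeneous_linForm (l j)).pow 2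
  have hwg : (linForm w * g).IsHomogeneous 9 := (isHomogeneous_linForm w).mul hghom
  have hX : ∀ i : Fin (3 + 1), algebraMap (MvPolynomial (Fin (3 + 1)) K)
      (FractionRing (MvPolynomial (Fin (3 + 1)) K)) (X i) ≠ 0 := fun i =>
    (map_ne_zero_iff _ (IsFractionRing.injective _ _)).2 (X_ne_zero i)
  have hXhom : ∀ (c : K) (i : Fin (3 + 1)), (C c * X i ^ 6).IsHomogeneous 6 := fun c i => by
    simpa using (isHomogeneous_C (Fin (3 + 1)) c).mul ((isHomogeneous_X K i).pow 6)
  -- The form `linForm w * g` has degree 9, so a sixth power in the denominator gives degree 3. The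
  -- constant `v 0 i ^ 6` makes all local sections have the same 1-jet at point `0` wherever they
  -- are defined there.
  refine _root_.cohomologyDim_one_pos (by norm_num)
    (fun i => algebraMap (MvPolynomial (Fin (3 + 1)) K) _
    (C (v 0 i ^ 6) * (linForm w * g)) / algebraMap (MvPolynomial (Fin (3 + 1)) K) _ (X i) ^ 6) ?_ ?_ ?_
  · intro i
    refine ⟨6, C (v 0 i ^ 6) * (linForm w * g), trivial, ?_, ?_⟩
    · rw [Finset.card_singleton]
      have hc := (isHomogeneous_C (Fin (3 + 1)) (v 0 i ^ 6)).mul hwg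
      rwa [zero_add] at hc
    · rw [Finset.prod_singleton, map_pow (algebraMap _ _) (X i) 6,
        div_mul_cancel₀ _ (pow_ne_zero _ (hX i))]
  · intro i j hij
    -- At point `0` both `linForm w` and the last factor vanish, so the product lies in the square
    -- of the ideal; at the other points `g` does.
    refine ⟨6, linForm w * g * (C (v 0 j ^ 6) * X i ^ 6 - C (v 0 i ^ 6) * X j ^ 6), ?_, ?_, ?_⟩
    · rw [mem_doublePointsIdeal]
      intro k
      by_cases hk : k = 0
      · subst hk
        obtain ⟨h0, h1⟩ := h 0
        rw [h1, mul_right_comm, pow_two]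
        refine Ideal.mul_mem_right _ _ (Ideal.mul_mem_mul (linForm_mem_pointIdeal h0 hw0) ?_)
        rw [mem_pointIdeal_mk]
        intro c
        simp
        ring
      · exact Ideal.mul_mem_right _ _ (Ideal.mul_mem_left _ _ (hgj k hk))
    · rw [Finset.card_pair hij]
      exact hwg.mul ((hXhom _ _).sub (hXhom _ _))
    · rw [Finset.prod_pair hij]
      have hi := hX i
      have hj := hX j
      simp only [map_mul, map_pow, map_sub]
      field_simp
  · intro F hF hFi
    have key : ∀ i, ∃ (N : ℕ) (a : MvPolynomial (Fin (3 + 1)) K),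
        a ∈ doublePointsIdeal (forgetOrder K 3 5 p) ∧
        X i ^ (N + 6) * F = X i ^ N * (C (v 0 i ^ 6) * (linForm w * g)) - a * X i ^ 6 := by
      intro i
      obtain ⟨N, a, ha, -, hNa⟩ := hFi i
      refine ⟨N, a, ha, ?_⟩
      apply IsFractionRing.injective (MvPolynomial (Fin (3 + 1)) K)
        (FractionRing (MvPolynomial (Fin (3 + 1)) K))
      rw [Finset.prod_singleton] at hNa
      have hi := hX i
      rw [map_sub, map_mul _ a, ← hNa]
      simp only [map_mul, map_pow]
      field_simp
      ring
    have hsing : ∀ j, j ≠ 0 → eval (v j) F = 0 ∧ ∀ u, eval (v j) (dirDeriv u F) = 0 := by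
      intro j hj
      obtain ⟨h0, h1⟩ := h j
      obtain ⟨i, hi⟩ := Function.ne_iff.1 h0
      obtain ⟨N, a, ha, hNa⟩ := key i
      refine singular_of_mul_mem_pointIdeal_sq h0 (G := X i ^ (N + 6)) ?_ ?_
      · simpa using hi
      · rw [hNa, ← h1]
        refine sub_mem (Ideal.mul_mem_left _ _ (Ideal.mul_mem_left _ _ (Ideal.mul_mem_left _ _
          (hgj j hj)))) (Ideal.mul_mem_right _ _ (mem_doublePointsIdeal.1 ha j))
    obtain ⟨h0, h1⟩ := h 0
    obtain ⟨i, hi⟩ := Function.ne_iff.1 h0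
    simp only [Pi.zero_apply] at hi
    obtain ⟨N, a, ha, hNa⟩ := key i
    have ha0 := mem_doublePointsIdeal.1 ha 0
    rw [h1] at ha0
    obtain ⟨ha1, ha2⟩ := singular_of_mem_pointIdeal_sq h0 ha0
    have hw0' : eval (v 0) (linForm w) = 0 := by rw [eval_linForm, hw0]
    have hF0 : eval (v 0) F = 0 := by
      have := congrArg (eval (v 0)) hNa
      simp only [map_mul, map_sub, map_pow, eval_X, ha1, hw0', zero_mul, mul_zero, sub_zero,
        mul_eq_zero] at this
      exact this.resolve_left (pow_ne_zero _ hi)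
    have hF1 : eval (v 0) (dirDeriv (v 1) F) = w ⬝ᵥ v 1 * eval (v 0) g := by
      have := congrArg (fun G => eval (v 0) (dirDeriv (v 1) G)) hNa
      simp only [eval_dirDeriv_mul, map_sub, map_mul, map_pow, hF0, hw0', ha1, ha2,
        eval_dirDeriv_linForm, eval_C, eval_X, mul_zero, zero_mul, add_zero, zero_add, sub_zero] at this
      apply mul_left_cancel₀ (pow_ne_zero (N + 6) hi)
      rw [this]
      ring
    -- The value at the meeting point of the two lines, computed along each: the first gives `w ⬝ᵥ v
    -- 1 * eval (v 0) g ≠ 0`, the second gives zero.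
    have e1 := hF.eval_cubic_add (v 0) (v 1) 1 1
    have e2 := hF.eval_cubic_add (v 2) (v 4) s t
    rw [one_smul, one_smul, hrel, e2] at e1
    simp only [hsing 1 one_ne_zero, hsing 2 (by decide), hsing 4 (by decide), hF0, hF1] at e1
    simp [hw1, hg0] at e1

theorem exists_plane (u₁ u₂ u₃ : Fin 4 → K) : ∃ l : Fin 4 → K, l ≠ 0 ∧
    l ⬝ᵥ u₁ = 0 ∧ l ⬝ᵥ u₂ = 0 ∧ l ⬝ᵥ u₃ = 0 := by
  obtain ⟨l, hl, h⟩ := exists_dotProduct_eq_zero (Submodule.span K (Set.range ![u₁, u₂, u₃])) (by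
    intro htop
    have h1 := finrank_range_le_card (R := K) ![u₁, u₂, u₃]
    rw [Set.finrank, htop] at h1
    simp at h1)
  exact ⟨l, hl, h _ (Submodule.subset_span ⟨0, rfl⟩), h _ (Submodule.subset_span ⟨1, rfl⟩),
    h _ (Submodule.subset_span ⟨2, rfl⟩)⟩

/-- A product of three planes is singular wherever two of them meet. Points `0, 1` lie on `l` and
`m`, points `2, 4` on `l` and `k`, and point `3` on `m` and `k`. -/
theorem OrderedPoints.Represents.cohomologyDim_zero_pos {p : OrderedPoints K 3 5}
    {b : Fin 4 → Fin 4 → K} {a : K} (h : p.Represents (configVectors b a)) :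
    0 < cohomologyDim (doublePointsIdeal (forgetOrder K 3 5 p)) 3 0 := by
  set v := configVectors b a with hv
  obtain ⟨l, hl, h0, h1, h2⟩ := exists_plane (v 0) (v 1) (v 2)
  have h4 : l ⬝ᵥ v 4 = 0 := by
    have : v 4 = v 0 + v 1 + a • v 2 := rfl
    rw [this, dotProduct_add, dotProduct_add, dotProduct_smul, h0, h1, h2]
    simp
  obtain ⟨m, hm, m0, m1, m3⟩ := exists_plane (v 0) (v 1) (v 3)
  obtain ⟨k, hk, k2, k4, k3⟩ := exists_plane (v 2) (v 4) (v 3)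
  refine _root_.cohomologyDim_zero_pos (F := linForm l * linForm m * linForm k)
    (((isHomogeneous_linForm l).mul (isHomogeneous_linForm m)).mul (isHomogeneous_linForm k))
    (mul_ne_zero (mul_ne_zero (linForm_ne_zero hl) (linForm_ne_zero hm)) (linForm_ne_zero hk)) ?_
  rw [mem_doublePointsIdeal]
  have hmem : ∀ (i : Fin 5) (l : Fin 4 → K), l ⬝ᵥ v i = 0 → linForm l ∈ pointIdeal (p.point i) := by
    intro i l hl
    obtain ⟨h0, h1⟩ := h i
    rw [h1]
    exact linForm_mem_pointIdeal h0 hl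
  intro i
  rw [pow_two]
  fin_cases i
  · exact Ideal.mul_mem_right _ _ (Ideal.mul_mem_mul (hmem 0 _ h0) (hmem 0 _ m0))
  · exact Ideal.mul_mem_right _ _ (Ideal.mul_mem_mul (hmem 1 _ h1) (hmem 1 _ m1))
  · rw [mul_right_comm]
    exact Ideal.mul_mem_right _ _ (Ideal.mul_mem_mul (hmem 2 _ h2) (hmem 2 _ k2))
  · rw [mul_assoc]
    exact Ideal.mul_mem_left _ _ (Ideal.mul_mem_mul (hmem 3 _ m3) (hmem 3 _ k3))
  · rw [mul_right_comm]
    exact Ideal.mul_mem_right _ _ (Ideal.mul_mem_mul (hmem 4 _ h4) (hmem 4 _ k4))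

theorem OrderedPoints.Represents.hasRelation_of_cohomologyDim_zero_pos [CharZero K]
    {p : OrderedPoints K 3 5} {v : Fin 5 → Fin 4 → K} (h : p.Represents v)
    (hpos : 0 < cohomologyDim (doublePointsIdeal (forgetOrder K 3 5 p)) 3 0) :
    HasRelation (K := K) v 4 := by
  obtain ⟨F, hF, hF0, hFI⟩ := exists_form_of_cohomologyDim_zero_pos (by norm_num) hpos
  have hsing : ∀ j, eval (v j) F = 0 ∧ ∀ u, eval (v j) (dirDeriv u F) = 0 := by
    intro j
    obtain ⟨h0, h1⟩ := h j
    obtain ⟨i, hi⟩ := Function.ne_iff.1 h0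
    obtain ⟨N, hN⟩ := hFI i
    refine singular_of_mul_mem_pointIdeal_sq h0 (G := X i ^ N) ?_ ?_
    · simpa using pow_ne_zero N hi
    · rw [← h1]
      exact mem_doublePointsIdeal.1 hN j
  exact hasRelation_of_singular_cubic hF hF0 (fun i => (hsing i).1) fun i => (hsing i).2

/-- The condition on `h¹` follows from the others: `h⁰ > 0` already yields the relation, and the
resulting normal form has both cohomology groups nonzero. -/
theorem forgetOrder_mem_terraciniLocus_iff [CharZero K] {p : OrderedPoints K 3 5}
    {v : Fin 5 → Fin 4 → K} (h : p.Represents v) :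
    forgetOrder K 3 5 p ∈ terraciniLocus K 3 3 5 ↔
      Submodule.span K (Set.range v) = ⊤ ∧ HasRelation (K := K) v 4 := by
  constructor
  · rintro ⟨hs, h0, -⟩
    exact ⟨(forgetOrder_spans_iff h).1 hs, h.hasRelation_of_cohomologyDim_zero_pos h0⟩
  · rintro ⟨hs, hr⟩
    obtain ⟨σ, b, a, -, -, hp⟩ := exists_configVectors h hs hr
    refine ⟨(forgetOrder_spans_iff h).2 hs, ?_⟩
    rw [forgetOrder_eq_iff.2 ⟨σ, rfl⟩]
    refine ⟨hp.cohomologyDim_zero_pos, hp.cohomologyDim_one_pos (s := -a) (t := 1) ?_⟩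
    simp [configVectors]

theorem mem_terraciniLocus_iff_isCoplanar [CharZero K] (S : PointSet K 3 5) :
    S ∈ terraciniLocus K 3 3 5 ↔
      S.Spans ∧ ∃ A ⊆ S.1, A.card = 4 ∧ IsCoplanar (A : Set (ℙ K (Fin (3 + 1) → K))) := by
  obtain ⟨p, rfl⟩ := forgetOrder_surjective S
  have h := p.represents_rep
  rw [forgetOrder_mem_terraciniLocus_iff h, ← forgetOrder_spans_iff h,
    ← exists_subset_mem_subspace_iff h (show 3 < 5 by norm_num)]
  rfl

theorem forgetOrder_mem_collinearTerracini_iff [CharZero K] {p : OrderedPoints K 3 5}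
    {v : Fin 5 → Fin 4 → K} (h : p.Represents v) :
    forgetOrder K 3 5 p ∈ collinearTerracini K 3 3 5 ↔
      forgetOrder K 3 5 p ∈ terraciniLocus K 3 3 5 ∧ HasRelation (K := K) v 3 := by
  rw [← exists_subset_mem_subspace_iff h (show 2 < 5 by norm_num)]
  rfl

theorem mem_terraciniLocus_iff_configVectors [CharZero K] (S : PointSet K 3 5) :
    S ∈ terraciniLocus K 3 3 5 ↔ ∃ (p : OrderedPoints K 3 5) (b : Fin 4 → Fin 4 → K) (a : K),
      LinearIndependent K b ∧ (a = 0 ∨ a = 1) ∧ p.Represents (configVectors b a) ∧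
        forgetOrder K 3 5 p = S := by
  constructor
  · intro hS
    obtain ⟨p, rfl⟩ := forgetOrder_surjective S
    have h := p.represents_rep
    obtain ⟨h1, h2⟩ := (forgetOrder_mem_terraciniLocus_iff h).1 hS
    obtain ⟨σ, b, a, hb, ha, hp⟩ := exists_configVectors h h1 h2
    exact ⟨_, b, a, hb, ha, hp, (forgetOrder_eq_iff.2 ⟨σ, rfl⟩).symm⟩
  · rintro ⟨p, b, a, hb, -, hp, rfl⟩
    exact (forgetOrder_mem_terraciniLocus_iff hp).2
      ⟨span_configVectors hb a, hasRelation_configVectors b a⟩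

theorem forgetOrder_configVectors_mem_collinearTerracini_iff [CharZero K] {p : OrderedPoints K 3 5}
    {b : Fin 4 → Fin 4 → K} (hb : LinearIndependent K b) {a : K}
    (h : p.Represents (configVectors b a)) :
    forgetOrder K 3 5 p ∈ collinearTerracini K 3 3 5 ↔ a = 0 := by
  rw [forgetOrder_mem_collinearTerracini_iff h, hasRelation_three_configVectors_iff hb,
    forgetOrder_mem_terraciniLocus_iff h]
  exact and_iff_right ⟨span_configVectors hb a, hasRelation_configVectors b a⟩

/-! ### The orbits of `PGL(4)` -/

theorem smul_mem_terraciniLocus [CharZero K] (g : Matrix.ProjGenLinGroup (Fin (3 + 1)) K)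
    {S : PointSet K 3 5} (hS : S ∈ terraciniLocus K 3 3 5) :
    g • S ∈ terraciniLocus K 3 3 5 := by
  induction g using Matrix.ProjGenLinGroup.induction_on with | mk g =>
  obtain ⟨p, rfl⟩ := forgetOrder_surjective S
  have h := p.represents_rep
  rw [smul_forgetOrder, forgetOrder_mem_terraciniLocus_iff (h.translate g)]
  obtain ⟨h1, h2⟩ := (forgetOrder_mem_terraciniLocus_iff h).1 hS
  refine ⟨?_, h2.mulVec g⟩
  have hsurj : LinearMap.range g.1.mulVecLin = ⊤ := by
    rw [LinearMap.range_eq_top]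
    exact Matrix.mulVec_surjective_iff_isUnit.2 g.isUnit
  have : (Set.range fun i => g.1.mulVec ((p.point i).rep)) =
      g.1.mulVecLin '' Set.range fun i => (p.point i).rep := by
    rw [← Set.range_comp]
    rfl
  rw [this, Submodule.span_image, h1, Submodule.map_top, hsurj]

theorem smul_mem_collinearTerracini [CharZero K] (g : Matrix.ProjGenLinGroup (Fin (3 + 1)) K)
    {S : PointSet K 3 5} (hS : S ∈ collinearTerracini K 3 3 5) :
    g • S ∈ collinearTerracini K 3 3 5 := by
  have hT := smul_mem_terraciniLocus g hS.1
  induction g using Matrix.ProjGenLinGroup.induction_on with | mk g =>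
  obtain ⟨p, rfl⟩ := forgetOrder_surjective S
  have h := p.represents_rep
  rw [smul_forgetOrder] at hT ⊢
  rw [forgetOrder_mem_collinearTerracini_iff (h.translate g)]
  exact ⟨hT, ((forgetOrder_mem_collinearTerracini_iff h).1 hS).2.mulVec g⟩

theorem exists_forgetOrder_mem_terraciniLocus [CharZero K] (a : K) (ha : a = 0 ∨ a = 1) :
    ∃ S : PointSet K 3 5, S ∈ terraciniLocus K 3 3 5 ∧ (S ∈ collinearTerracini K 3 3 5 ↔ a = 0) ∧
      MulAction.orbit (Matrix.ProjGenLinGroup (Fin (3 + 1)) K) S = {S' | ∃ (p : OrderedPoints K 3 5)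
        (b : Fin 4 → Fin 4 → K), LinearIndependent K b ∧ p.Represents (configVectors b a) ∧
        forgetOrder K 3 5 p = S'} := by
  have hb := (Pi.basisFun K (Fin 4)).linearIndependent
  obtain ⟨p, hp⟩ := exists_represents_configVectors hb a
  refine ⟨forgetOrder K 3 5 p, ?_, ?_, ?_⟩
  · exact (mem_terraciniLocus_iff_configVectors _).2 ⟨p, _, a, hb, ha, hp, rfl⟩
  · exact forgetOrder_configVectors_mem_collinearTerracini_iff hb hp
  · ext S'
    constructor
    · rintro ⟨g, rfl⟩
      induction g using Matrix.ProjGenLinGroup.induction_on with | mk g =>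
      refine ⟨_, fun i => g.1.mulVec (Pi.basisFun K (Fin 4) i), ?_, ?_,
        (smul_forgetOrder (Matrix.ProjGenLinGroup.mk g) p).symm⟩
      · exact hb.map' g.1.mulVecLin (LinearMap.ker_eq_bot.2
          (Matrix.mulVec_injective_iff_isUnit.2 g.isUnit))
      · have := hp.translate g
        convert this using 1
        funext i
        fin_cases i <;> simp [configVectors, Matrix.mulVec_add, Matrix.mulVec_smul]
    · rintro ⟨p', b, hb', hp', rfl⟩
      obtain ⟨g, rfl⟩ := exists_translate_configVectors hb hb' hp hp'
      exact ⟨g, smul_forgetOrder g p⟩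

theorem orbits_terraciniLocus [CharZero K] :
    MulAction.orbit (Matrix.ProjGenLinGroup (Fin (3 + 1)) K) '' terraciniLocus K 3 3 5 =
      {collinearTerracini K 3 3 5, terraciniLocus K 3 3 5 \ collinearTerracini K 3 3 5} ∧
      collinearTerracini K 3 3 5 ≠ terraciniLocus K 3 3 5 \ collinearTerracini K 3 3 5 := by
  obtain ⟨S₀, hT₀, hC₀, hO₀⟩ := exists_forgetOrder_mem_terraciniLocus (0 : K) (Or.inl rfl)
  obtain ⟨S₁, hT₁, hC₁, hO₁⟩ := exists_forgetOrder_mem_terraciniLocus (1 : K) (Or.inr rfl)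
  replace hC₀ := hC₀.2 rfl
  replace hC₁ : S₁ ∉ collinearTerracini K 3 3 5 := fun h => one_ne_zero (hC₁.1 h)
  have e₀ : MulAction.orbit (Matrix.ProjGenLinGroup (Fin (3 + 1)) K) S₀ =
      collinearTerracini K 3 3 5 := by
    apply Set.Subset.antisymm
    · rintro _ ⟨g, rfl⟩
      exact smul_mem_collinearTerracini g hC₀
    · intro S hS
      obtain ⟨p, b, a, hb, -, hp, rfl⟩ := (mem_terraciniLocus_iff_configVectors S).1 hS.1
      obtain rfl := (forgetOrder_configVectors_mem_collinearTerracini_iff hb hp).1 hS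
      rw [hO₀]
      exact ⟨p, b, hb, hp, rfl⟩
  have e₁ : MulAction.orbit (Matrix.ProjGenLinGroup (Fin (3 + 1)) K) S₁ =
      terraciniLocus K 3 3 5 \ collinearTerracini K 3 3 5 := by
    apply Set.Subset.antisymm
    · rintro _ ⟨g, rfl⟩
      refine ⟨smul_mem_terraciniLocus g hT₁, fun h => hC₁ ?_⟩
      have := smul_mem_collinearTerracini g⁻¹ h
      simpa using this
    · rintro S ⟨hS, hS'⟩
      obtain ⟨p, b, a, hb, ha, hp, rfl⟩ := (mem_terraciniLocus_iff_configVectors S).1 hS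
      rw [forgetOrder_configVectors_mem_collinearTerracini_iff hb hp] at hS'
      obtain rfl := ha.resolve_left hS'
      rw [hO₁]
      exact ⟨p, b, hb, hp, rfl⟩
  refine ⟨?_, fun h => ?_⟩
  · apply Set.Subset.antisymm
    · rintro _ ⟨S, hS, rfl⟩
      by_cases hC : S ∈ collinearTerracini K 3 3 5
      · rw [← e₀] at hC
        exact Or.inl ((MulAction.orbit_eq_iff.2 hC).trans e₀)
      · have : S ∈ terraciniLocus K 3 3 5 \ collinearTerracini K 3 3 5 := ⟨hS, hC⟩
        rw [← e₁] at this
        exact Or.inr ((MulAction.orbit_eq_iff.2 this).trans e₁)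
    · rintro _ (rfl | rfl)
      · exact ⟨S₀, hT₀, e₀⟩
      · exact ⟨S₁, hT₁, e₁⟩
  · have := hC₀
    rw [h] at this
    exact this.2 hC₀

end TerraciniSet

/-! ### The Zariski topology on tuples of points -/

section Zariski

open MvPolynomial TopologicalSpace

variable {K : Type*} [Field K] {n x : ℕ}

theorem weight_single_apply (d : Fin x × Fin (n + 1) →₀ ℕ) (i : Fin x) :
    Finsupp.weight (fun ij : Fin x × Fin (n + 1) => (Pi.single ij.1 1 : Fin x → ℕ)) d i =
      ∑ j, d (i, j) := by
  rw [Finsupp.weight_apply, Finsupp.sum_fintype _ _ (by simp), Finset.sum_apply,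
    Fintype.sum_prod_type]
  simp [Pi.single_apply]

theorem isMultihomogeneous_iff {f : MvPolynomial (Fin x × Fin (n + 1)) K} :
    IsMultihomogeneous f ↔
      ∃ m : Fin x → ℕ, ∀ d, coeff d f ≠ 0 → ∀ i, ∑ j, d (i, j) = m i := by
  refine exists_congr fun m => forall_congr' fun d => imp_congr_right fun _ => ?_
  rw [funext_iff]
  simp only [weight_single_apply]

theorem MvPolynomial.IsWeightedHomogeneous.eval_mul {f : MvPolynomial (Fin x × Fin (n + 1)) K}
    {m : Fin x → ℕ} (hf : f.IsWeightedHomogeneous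
      (fun ij : Fin x × Fin (n + 1) => (Pi.single ij.1 1 : Fin x → ℕ)) m)
    (c : Fin x → K) (y : Fin x × Fin (n + 1) → K) :
    eval (fun ij => c ij.1 * y ij) f = (∏ i, c i ^ m i) * eval y f := by
  rw [eval_eq', eval_eq', Finset.mul_sum]
  refine Finset.sum_congr rfl fun d hd => ?_
  have hm : ∀ i, ∑ j, d (i, j) = m i := fun i => by
    rw [← weight_single_apply, hf (mem_support_iff.1 hd)]
  simp only [mul_pow, Finset.prod_mul_distrib]
  have : ∏ ij : Fin x × Fin (n + 1), c ij.1 ^ d ij = ∏ i, c i ^ m i := by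
    rw [Fintype.prod_prod_type]
    simp only [Finset.prod_pow_eq_pow_sum, hm]
  rw [this]
  ring

theorem OrderedPoints.Represents.mem_nonvanishingLocus_iff {p : OrderedPoints K n x}
    {v : Fin x → Fin (n + 1) → K} (h : p.Represents v)
    {f : MvPolynomial (Fin x × Fin (n + 1)) K} (hf : IsMultihomogeneous f) :
    p ∈ nonvanishingLocus f ↔ eval (fun ij => v ij.1 ij.2) f ≠ 0 := by
  obtain ⟨c, rfl⟩ := p.represents_rep.exists_smul h
  obtain ⟨m, hm⟩ := hf
  have : (fun ij : Fin x × Fin (n + 1) => (c ij.1 • (p.point ij.1).rep) ij.2) =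
      fun ij => (c ij.1 : K) * (p.point ij.1).rep ij.2 := rfl
  simp only [this]
  rw [hm.eval_mul (fun i => (c i : K)), mul_ne_zero_iff]
  exact (and_iff_right (Finset.prod_ne_zero_iff.2 fun i _ => pow_ne_zero _ (c i).ne_zero)).symm

theorem OrderedPoints.isTopologicalBasis : IsTopologicalBasis (insert Set.univ
    {U : Set (OrderedPoints K n x) | ∃ f : MvPolynomial (Fin x × Fin (n + 1)) K,
      IsMultihomogeneous f ∧ U = nonvanishingLocus f}) := by
  refine isTopologicalBasis_of_subbasis_of_inter rfl ?_
  rintro _ ⟨f, ⟨m, hf⟩, rfl⟩ _ ⟨g, ⟨m', hg⟩, rfl⟩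
  refine ⟨f * g, ⟨m + m', hf.mul hg⟩, ?_⟩
  ext p
  simp [nonvanishingLocus]

theorem isMultihomogeneous_one : IsMultihomogeneous (1 : MvPolynomial (Fin x × Fin (n + 1)) K) :=
  ⟨0, isWeightedHomogeneous_one _ _⟩

theorem OrderedPoints.exists_nonvanishingLocus_subset {U : Set (OrderedPoints K n x)}
    (hU : IsOpen U) {p : OrderedPoints K n x} (hp : p ∈ U) :
    ∃ f : MvPolynomial (Fin x × Fin (n + 1)) K, IsMultihomogeneous f ∧ p ∈ nonvanishingLocus f ∧
      nonvanishingLocus f ⊆ U := by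
  obtain ⟨V, hV, hpV, hVU⟩ := OrderedPoints.isTopologicalBasis.exists_subset_of_mem_open hp hU
  rcases hV with rfl | ⟨f, hf, rfl⟩
  · exact ⟨1, isMultihomogeneous_one, by simp [nonvanishingLocus], (Set.subset_univ _).trans hVU⟩
  · exact ⟨f, hf, hpV, hVU⟩

theorem isOpen_nonvanishingLocus {f : MvPolynomial (Fin x × Fin (n + 1)) K}
    (hf : IsMultihomogeneous f) : IsOpen (nonvanishingLocus f) :=
  isOpen_generateFrom_of_mem ⟨f, hf, rfl⟩

theorem isMultihomogeneous_rename {f : MvPolynomial (Fin x × Fin (n + 1)) K}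
    (hf : IsMultihomogeneous f) (σ : Equiv.Perm (Fin x)) :
    IsMultihomogeneous (rename (Prod.map σ id) f) := by
  obtain ⟨m, hm⟩ := isMultihomogeneous_iff.1 hf
  refine isMultihomogeneous_iff.2 ⟨fun i => m (σ⁻¹ i), fun d hd i => ?_⟩
  obtain ⟨u, rfl, hu⟩ := coeff_rename_ne_zero _ _ _ hd
  change _ = m (σ⁻¹ i)
  rw [← hm u hu (σ⁻¹ i)]
  refine Finset.sum_congr rfl fun j _ => ?_
  have hinj : Function.Injective (Prod.map σ id : Fin x × Fin (n + 1) → Fin x × Fin (n + 1)) :=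
    σ.injective.prodMap Function.injective_id
  have := Finsupp.mapDomain_apply hinj u (σ⁻¹ i, j)
  simpa using this

instance OrderedPoints.continuousConstSMul :
    ContinuousConstSMul (Equiv.Perm (Fin x)) (OrderedPoints K n x) where
  continuous_const_smul σ := by
    refine continuous_generateFrom_iff.2 ?_
    rintro _ ⟨f, hf, rfl⟩
    convert isOpen_nonvanishingLocus (isMultihomogeneous_rename hf σ⁻¹) using 1
    ext p
    simp only [nonvanishingLocus, Set.mem_preimage, Set.mem_ofPred_eq, eval_rename]
    rfl

theorem continuous_forgetOrder : Continuous (forgetOrder K n x) := continuous_coinduced_rng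

theorem isClosedMap_forgetOrder : IsClosedMap (forgetOrder K n x) := by
  intro C hC
  rw [isClosed_coinduced]
  have : forgetOrder K n x ⁻¹' (forgetOrder K n x '' C) =
      ⋃ σ : Equiv.Perm (Fin x), (fun p => σ • p) ⁻¹' C := by
    ext p
    simp only [Set.mem_preimage, Set.mem_image, Set.mem_iUnion]
    constructor
    · rintro ⟨p', hp', h⟩
      obtain ⟨σ, rfl⟩ := forgetOrder_eq_iff.1 h.symm
      exact ⟨σ, hp'⟩
    · rintro ⟨σ, hσ⟩
      exact ⟨_, hσ, (forgetOrder_eq_iff.2 ⟨σ, rfl⟩).symm⟩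
  rw [this]
  exact isClosed_iUnion_of_finite fun σ => hC.preimage (continuous_const_smul σ)

/-- A set of point sets has the dimension of the corresponding set of tuples. -/
theorem topologicalKrullDim_preimage_forgetOrder (S : Set (PointSet K n x)) :
    topologicalKrullDim (forgetOrder K n x ⁻¹' S) = topologicalKrullDim S := by
  have hmem : ∀ (σ : Equiv.Perm (Fin x)) (p : OrderedPoints K n x), p ∈ forgetOrder K n x ⁻¹' S →
      σ • p ∈ forgetOrder K n x ⁻¹' S := by
    intro σ p hp
    rw [Set.mem_preimage, ← forgetOrder_eq_iff.2 ⟨σ, rfl⟩]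
    exact hp
  let _ : MulAction (Equiv.Perm (Fin x)) (forgetOrder K n x ⁻¹' S) :=
    { smul := fun σ p => ⟨σ • p.1, hmem σ p.1 p.2⟩
      one_smul := fun _ => rfl
      mul_smul := fun _ _ _ => rfl }
  have : ContinuousConstSMul (Equiv.Perm (Fin x)) (forgetOrder K n x ⁻¹' S) :=
    ⟨fun σ => ((continuous_const_smul σ).comp continuous_subtype_val).subtype_mk
      fun p => hmem σ p.1 p.2⟩
  refine topologicalKrullDim_eq_of_finite_quotient (G := Equiv.Perm (Fin x))
    (q := S.restrictPreimage (forgetOrder K n x)) continuous_forgetOrder.restrictPreimage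
    (isClosedMap_forgetOrder.restrictPreimage S)
    (Set.restrictPreimage_surjective S forgetOrder_surjective) ?_
  intro p p'
  rw [Subtype.ext_iff]
  refine forgetOrder_eq_iff.trans (exists_congr fun σ => ?_)
  rw [Subtype.ext_iff]
  rfl

/-- A set of tuples parametrized by polynomials is irreducible. -/
theorem OrderedPoints.isIrreducible_of_parametrization [Infinite K] {ι : Type*}
    (V : Fin x → Fin (n + 1) → MvPolynomial ι K) {h : MvPolynomial ι K} (hne : h ≠ 0)
    (hV : ∀ y, eval y h ≠ 0 → ∃ p : OrderedPoints K n x,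
      p.Represents fun i j => eval y (V i j)) :
    IsIrreducible {p : OrderedPoints K n x |
      ∃ y, eval y h ≠ 0 ∧ p.Represents fun i j => eval y (V i j)} := by
  have hex : ∀ g : MvPolynomial ι K, g ≠ 0 → ∃ y, eval y g ≠ 0 := by
    intro g hg
    by_contra! h0
    exact hg (MvPolynomial.funext fun y => by rw [h0, map_zero])
  have heval : ∀ (f : MvPolynomial (Fin x × Fin (n + 1)) K) (y : ι → K),
      eval y (bind₁ (fun ij => V ij.1 ij.2) f) = eval (fun ij => eval y (V ij.1 ij.2)) f := by
    intro f y
    rw [eval, eval₂Hom_bind₁]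
    rfl
  refine ⟨?_, ?_⟩
  · obtain ⟨y, hy⟩ := hex h hne
    obtain ⟨p, hp⟩ := hV y hy
    exact ⟨p, y, hy, hp⟩
  · rintro U U' hU hU' ⟨p, ⟨y, hy, hp⟩, hpU⟩ ⟨p', ⟨y', hy', hp'⟩, hpU'⟩
    obtain ⟨f, hf, hpf, hfU⟩ := OrderedPoints.exists_nonvanishingLocus_subset hU hpU
    obtain ⟨f', hf', hpf', hfU'⟩ := OrderedPoints.exists_nonvanishingLocus_subset hU' hpU'
    rw [hp.mem_nonvanishingLocus_iff hf, ← heval] at hpf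
    rw [hp'.mem_nonvanishingLocus_iff hf', ← heval] at hpf'
    -- Both open conditions pull back to nonvanishing of nonzero polynomials in the parameters.
    -- Their product with `h` is nonzero, so it is nonzero at some point of the infinite field.
    have h1 : bind₁ (fun ij => V ij.1 ij.2) f ≠ 0 := fun h0 => hpf (by rw [h0, map_zero])
    have h2 : bind₁ (fun ij => V ij.1 ij.2) f' ≠ 0 := fun h0 => hpf' (by rw [h0, map_zero])
    obtain ⟨z, hz⟩ := hex _ (mul_ne_zero (mul_ne_zero h1 h2) hne)
    rw [map_mul, map_mul, mul_ne_zero_iff, mul_ne_zero_iff, heval, heval] at hz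
    obtain ⟨⟨z1, z2⟩, z3⟩ := hz
    obtain ⟨r, hr⟩ := hV z z3
    exact ⟨r, ⟨z, z3, hr⟩, hfU ((hr.mem_nonvanishingLocus_iff hf).2 z1),
      hfU' ((hr.mem_nonvanishingLocus_iff hf').2 z2)⟩

/-! ### Multicones and the upper bound for the dimension -/

/-- The polynomials vanishing on the multicone over a set of tuples of points. -/
noncomputable def coneIdeal (Z : Set (OrderedPoints K n x)) :
    Ideal (MvPolynomial (Fin x × Fin (n + 1)) K) :=
  vanishingIdeal K {y | ∃ p ∈ Z, ∃ c : Fin x → K, y = fun ij => c ij.1 * (p.point ij.1).rep ij.2}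

theorem mem_coneIdeal {Z : Set (OrderedPoints K n x)}
    {f : MvPolynomial (Fin x × Fin (n + 1)) K} :
    f ∈ coneIdeal Z ↔ ∀ p ∈ Z, ∀ c : Fin x → K,
      eval (fun ij => c ij.1 * (p.point ij.1).rep ij.2) f = 0 := by
  unfold coneIdeal
  rw [mem_vanishingIdeal_iff]
  constructor
  · intro h p hp c
    exact h _ ⟨p, hp, c, rfl⟩
  · rintro h _ ⟨p, hp, c, rfl⟩
    exact h p hp c

theorem mem_coneIdeal_of_isMultihomogeneous {Z : Set (OrderedPoints K n x)}
    {f : MvPolynomial (Fin x × Fin (n + 1)) K} (hf : IsMultihomogeneous f) :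
    f ∈ coneIdeal Z ↔ Disjoint Z (nonvanishingLocus f) := by
  rw [mem_coneIdeal, Set.disjoint_left]
  refine forall₂_congr fun p _ => ?_
  obtain ⟨m, hm⟩ := hf
  constructor
  · intro h hp
    apply hp
    simpa using h 1
  · intro h c
    rw [hm.eval_mul c fun ij => (p.point ij.1).rep ij.2, mul_eq_zero]
    exact Or.inr (not_not.1 h)

/-- The restriction of a polynomial to the cone over a tuple of points. -/
noncomputable def coneRestriction (p : OrderedPoints K n x) :
    MvPolynomial (Fin x × Fin (n + 1)) K →ₐ[K] MvPolynomial (Fin x) K :=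
  aeval fun ij => X ij.1 * C ((p.point ij.1).rep ij.2)

theorem eval_coneRestriction (p : OrderedPoints K n x)
    (f : MvPolynomial (Fin x × Fin (n + 1)) K) (c : Fin x → K) :
    eval c (coneRestriction p f) = eval (fun ij => c ij.1 * (p.point ij.1).rep ij.2) f := by
  have := eval₂Hom_bind₁ (RingHom.id K) c
    (fun ij : Fin x × Fin (n + 1) => X ij.1 * C ((p.point ij.1).rep ij.2)) f
  have h : (fun ij : Fin x × Fin (n + 1) => eval₂Hom (RingHom.id K) c
      (X ij.1 * C ((p.point ij.1).rep ij.2))) = fun ij => c ij.1 * (p.point ij.1).rep ij.2 := by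
    funext ij
    change eval c _ = _
    rw [map_mul, eval_X, eval_C]
  rw [h] at this
  exact this

theorem coneRestriction_of_isWeightedHomogeneous [Infinite K] (p : OrderedPoints K n x)
    {f : MvPolynomial (Fin x × Fin (n + 1)) K} {m : Fin x → ℕ} (hf : f.IsWeightedHomogeneous
      (fun ij : Fin x × Fin (n + 1) => (Pi.single ij.1 1 : Fin x → ℕ)) m) :
    coneRestriction p f = monomial (Finsupp.equivFunOnFinite.symm m)
      (eval (fun ij => (p.point ij.1).rep ij.2) f) := by
  apply MvPolynomial.funext
  intro c
  rw [eval_coneRestriction, hf.eval_mul c fun ij => (p.point ij.1).rep ij.2, eval_monomial,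
    mul_comm, Finsupp.prod_fintype _ _ (by simp)]
  simp

/-- The multihomogeneous components of `f` restrict to multiples of distinct monomials on the cone
over a tuple, so they cannot cancel. Thus `f` is nonzero on the cone over `p` exactly when some
component is nonzero at `p`, an open condition on `p`. -/
theorem coneRestriction_ne_zero_iff [Infinite K] (f : MvPolynomial (Fin x × Fin (n + 1)) K) :
    ∃ s : Set (MvPolynomial (Fin x × Fin (n + 1)) K), (∀ g ∈ s, IsMultihomogeneous g) ∧
      ∀ p, coneRestriction p f ≠ 0 ↔ ∃ g ∈ s, p ∈ nonvanishingLocus g := by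
  classical
  set w := fun ij : Fin x × Fin (n + 1) => (Pi.single ij.1 1 : Fin x → ℕ) with hw
  have hhom : ∀ m, (weightedHomogeneousComponent w m f).IsWeightedHomogeneous w m := fun m =>
    weightedHomogeneousComponent_isWeightedHomogeneous m f
  refine ⟨Set.range fun m => weightedHomogeneousComponent w m f, ?_, fun p => ?_⟩
  · rintro _ ⟨m, rfl⟩
    exact ⟨m, hhom m⟩
  have hfin : (Function.support fun m => weightedHomogeneousComponent w m f).Finite :=
    weightedHomogeneousComponent_finsupp f
  have hsum : coneRestriction p f = ∑ m ∈ hfin.toFinset,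
      monomial (Finsupp.equivFunOnFinite.symm m)
        (eval (fun ij => (p.point ij.1).rep ij.2) (weightedHomogeneousComponent w m f)) := by
    conv_lhs => rw [← sum_weightedHomogeneousComponent w f, finsum_eq_sum _ hfin, map_sum]
    exact Finset.sum_congr rfl fun m _ => coneRestriction_of_isWeightedHomogeneous p (hhom m)
  constructor
  · intro h
    rw [hsum] at h
    obtain ⟨m, -, hm⟩ := Finset.exists_ne_zero_of_sum_ne_zero h
    exact ⟨_, ⟨m, rfl⟩, fun h0 => hm (by rw [h0, monomial_zero])⟩
  · rintro ⟨_, ⟨m, rfl⟩, hp⟩ h0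
    have hmem : m ∈ hfin.toFinset := by
      rw [Set.Finite.mem_toFinset, Function.mem_support]
      intro h1
      apply hp
      simp only [h1, map_zero]
    have := congrArg (coeff (Finsupp.equivFunOnFinite.symm m)) hsum
    rw [h0, coeff_zero, coeff_sum, Finset.sum_eq_single m] at this
    · rw [coeff_monomial, if_pos rfl] at this
      exact hp this.symm
    · intro m' _ hne
      rw [coeff_monomial, if_neg]
      exact fun h => hne (Finsupp.equivFunOnFinite.symm.injective h)
    · exact fun h => absurd hmem h

theorem mem_coneIdeal_iff_coneRestriction [Infinite K] {Z : Set (OrderedPoints K n x)}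
    {f : MvPolynomial (Fin x × Fin (n + 1)) K} :
    f ∈ coneIdeal Z ↔ ∀ p ∈ Z, coneRestriction p f = 0 := by
  rw [mem_coneIdeal]
  refine forall₂_congr fun p _ => ?_
  simp only [← eval_coneRestriction]
  constructor
  · exact fun h => MvPolynomial.funext fun c => by rw [h, map_zero]
  · exact fun h c => by rw [h, map_zero]

/-- If neither `f` nor `g` vanishes on the multicone, the tuples over which each is nonzero form
open sets meeting `Z`, so by irreducibility they share a tuple in `Z`. The restrictions to its cone
lie in a domain, so their product is nonzero. -/
theorem isPrime_coneIdeal [Infinite K] {Z : Set (OrderedPoints K n x)} (hZ : IsIrreducible Z) :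
    (coneIdeal Z).IsPrime := by
  have hopen : ∀ f : MvPolynomial (Fin x × Fin (n + 1)) K,
      IsOpen {p : OrderedPoints K n x | coneRestriction p f ≠ 0} := by
    intro f
    obtain ⟨s, hs, h⟩ := coneRestriction_ne_zero_iff f
    have : {p : OrderedPoints K n x | coneRestriction p f ≠ 0} =
        ⋃ g ∈ s, nonvanishingLocus g := by
      ext p
      simp [h]
    rw [this]
    exact isOpen_biUnion fun g hg => isOpen_nonvanishingLocus (hs g hg)
  rw [Ideal.isPrime_iff]
  constructor
  · rw [Ne, Ideal.eq_top_iff_one, mem_coneIdeal_iff_coneRestriction]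
    obtain ⟨p, hp⟩ := hZ.nonempty
    intro h
    have := h p hp
    rw [map_one] at this
    exact one_ne_zero this
  · intro f g hfg
    by_contra! h
    obtain ⟨h1, h2⟩ := h
    rw [mem_coneIdeal_iff_coneRestriction] at h1 h2 hfg
    push Not at h1 h2
    obtain ⟨p, hp, hpf⟩ := h1
    obtain ⟨p', hp', hpg⟩ := h2
    obtain ⟨r, hr, hrf, hrg⟩ := hZ.isPreirreducible _ _ (hopen f) (hopen g) ⟨p, hp, hpf⟩
      ⟨p', hp', hpg⟩
    have := hfg r hr
    rw [map_mul, mul_eq_zero] at this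
    exact this.elim hrf hrg

theorem coneIdeal_lt {Z Z' : Set (OrderedPoints K n x)} (hZ : IsClosed Z) (h : Z ⊂ Z') :
    coneIdeal Z' < coneIdeal Z := by
  refine lt_of_le_not_ge (fun f hf => ?_) fun hle => ?_
  · rw [mem_coneIdeal] at hf ⊢
    exact fun p hp => hf p (h.subset hp)
  · obtain ⟨p, hp', hp⟩ := Set.exists_of_ssubset h
    obtain ⟨f, hf, hpf, hfZ⟩ := OrderedPoints.exists_nonvanishingLocus_subset hZ.isOpen_compl hp
    have h1 : f ∈ coneIdeal Z := by
      rw [mem_coneIdeal_of_isMultihomogeneous hf]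
      exact Set.disjoint_left.2 fun q hq hqf => hfZ hqf hq
    have h2 := hle h1
    rw [mem_coneIdeal_of_isMultihomogeneous hf] at h2
    exact Set.disjoint_left.1 h2 hp' hpf

/-- The polynomials vanishing on the part of the cone over a tuple where the first `k` components
are zero. -/
noncomputable def partialConeIdeal (p : OrderedPoints K n x) (k : ℕ) :
    Ideal (MvPolynomial (Fin x × Fin (n + 1)) K) :=
  RingHom.ker ((aeval fun i : Fin x => if (i : ℕ) < k then 0 else (X i : MvPolynomial (Fin x) K) :
    MvPolynomial (Fin x) K →ₐ[K] MvPolynomial (Fin x) K).comp (coneRestriction p))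

instance (p : OrderedPoints K n x) (k : ℕ) : (partialConeIdeal p k).IsPrime :=
  RingHom.ker_isPrime _

theorem mem_partialConeIdeal [Infinite K] {p : OrderedPoints K n x} {k : ℕ}
    {f : MvPolynomial (Fin x × Fin (n + 1)) K} :
    f ∈ partialConeIdeal p k ↔ ∀ c : Fin x → K, (∀ i : Fin x, (i : ℕ) < k → c i = 0) →
      eval c (coneRestriction p f) = 0 := by
  have heval : ∀ (g : MvPolynomial (Fin x) K) (c : Fin x → K), eval c ((aeval fun i : Fin x =>
      if (i : ℕ) < k then 0 else (X i : MvPolynomial (Fin x) K)) g) =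
        eval (fun i : Fin x => if (i : ℕ) < k then 0 else c i) g := by
    intro g c
    refine (eval₂Hom_bind₁ (RingHom.id K) c _ g).trans ?_
    have : (fun i : Fin x => (eval₂Hom (RingHom.id K) c)
        (if (i : ℕ) < k then 0 else (X i : MvPolynomial (Fin x) K))) =
          fun i : Fin x => if (i : ℕ) < k then 0 else c i := by
      funext i
      split_ifs <;> simp
    rw [this]
    rfl
  unfold partialConeIdeal
  rw [RingHom.mem_ker]
  constructor
  · intro h c hc
    have h1 := congrArg (eval c) h
    have hc' : (fun i : Fin x => if (i : ℕ) < k then 0 else c i) = c := by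
      funext i
      split_ifs with hi
      · exact (hc i hi).symm
      · rfl
    rw [map_zero] at h1
    rw [← hc', ← heval]
    exact h1
  · intro h
    apply MvPolynomial.funext
    intro c
    rw [map_zero]
    refine (heval _ _).trans (h _ fun i hi => if_pos hi)

/-- The cone over one tuple has dimension `x`: killing its scaling factors one after another gives
`x` strict inclusions of primes. These account for the difference between a multicone and its base.
-/
theorem partialConeIdeal_lt [Infinite K] (p : OrderedPoints K n x) {k : ℕ} (hk : k < x) :
    partialConeIdeal p k < partialConeIdeal p (k + 1) := by
  refine lt_of_le_not_ge (fun f hf => ?_) fun hle => ?_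
  · rw [mem_partialConeIdeal] at hf ⊢
    exact fun c hc => hf c fun i hi => hc i (by omega)
  · obtain ⟨j, hj⟩ := Function.ne_iff.1 (p.point ⟨k, hk⟩).rep_nonzero
    have h1 : X (⟨k, hk⟩, j) ∈ partialConeIdeal p (k + 1) := by
      rw [mem_partialConeIdeal]
      intro c hc
      rw [eval_coneRestriction, eval_X, hc ⟨k, hk⟩ (Nat.lt_succ_self k), zero_mul]
    have h2 := mem_partialConeIdeal.1 (hle h1) (Pi.single ⟨k, hk⟩ 1) fun i hi =>
      Pi.single_eq_of_ne (by rintro rfl; exact lt_irrefl _ hi) _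
    rw [eval_coneRestriction, eval_X] at h2
    simp at h2
    exact hj h2

/-- A set of `x`-tuples of points of `ℙⁿ` on which some nonzero multihomogeneous polynomial
vanishes has dimension less than `n x`. -/
theorem topologicalKrullDim_le_of_disjoint_nonvanishingLocus [Infinite K] (Y : Set (OrderedPoints K n x))
    {f : MvPolynomial (Fin x × Fin (n + 1)) K} (hf : IsMultihomogeneous f) (hf0 : f ≠ 0)
    (hY : Disjoint Y (nonvanishingLocus f)) {d : ℕ} (hd : x * n = d + 1) :
    topologicalKrullDim Y ≤ d := by
  have hd' : x * (n + 1) = d + 1 + x := by rw [mul_add_one, hd]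
  have hdim : Order.krullDim (PrimeSpectrum (MvPolynomial (Fin x × Fin (n + 1)) K)) =
      (x * (n + 1) : ℕ) := by
    have := ringKrullDim_of_isNoetherianRing (R := K) (ι := Fin x × Fin (n + 1))
    rw [ringKrullDim_eq_zero_of_field] at this
    simpa [ringKrullDim] using this
  -- Below the prime of the smallest member stand the primes of the chain and the zero ideal, which
  -- is strictly smaller because it does not contain `f`: this gives `r.length + 1`. Above it stand
  -- the `x` steps in the cone over one tuple. Height plus coheight is bounded by the number of
  -- variables.
  have key : ∀ r : LTSeries (IrreducibleCloseds Y), r.length + 1 + x ≤ x * (n + 1) := by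
    intro r
    let F : IrreducibleCloseds Y → PrimeSpectrum (MvPolynomial (Fin x × Fin (n + 1)) K) := fun Z =>
      ⟨coneIdeal (closure (Subtype.val '' (Z : Set Y))), isPrime_coneIdeal
        (Z.isIrreducible.image _ continuous_subtype_val.continuousOn).closure⟩
    have hF : ∀ Z Z', Z < Z' → F Z' < F Z := by
      intro Z Z' h
      refine coneIdeal_lt isClosed_closure ?_
      exact IrreducibleCloseds.map_strictMono_of_isInducing Topology.IsInducing.subtypeVal h
    have hfF : ∀ Z, f ∈ (F Z).asIdeal := by
      intro Z
      refine (mem_coneIdeal_of_isMultihomogeneous hf).2 ?_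
      refine Disjoint.closure_left ?_ (isOpen_nonvanishingLocus hf)
      refine hY.mono_left ?_
      rintro _ ⟨y, -, rfl⟩
      exact y.2
    let s : LTSeries (PrimeSpectrum (MvPolynomial (Fin x × Fin (n + 1)) K)) :=
      LTSeries.mk r.length (fun i => F (r i.rev)) fun i j hij =>
        hF _ _ (r.strictMono (Fin.rev_lt_rev.2 hij))
    let s' := s.cons ⟨⊥, Ideal.isPrime_bot⟩ (by
      refine lt_of_le_of_ne (show (⊥ : Ideal _) ≤ _ from bot_le) fun h0 => hf0 ?_
      have : f ∈ s.head.asIdeal := hfF (r (Fin.rev 0))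
      rw [← h0] at this
      exact this)
    have hs' : s'.last = F (r 0) := by
      rw [RelSeries.last_cons]
      change F (r (Fin.last _).rev) = _
      rw [Fin.rev_last]
    have h1 := Order.length_le_height (p := s') (x := F (r 0)) hs'.le
    obtain ⟨p, hp⟩ := (r 0).isIrreducible.nonempty
    let t : LTSeries (PrimeSpectrum (MvPolynomial (Fin x × Fin (n + 1)) K)) :=
      LTSeries.mk x (fun i => ⟨partialConeIdeal p.1 i, inferInstance⟩)
        (Fin.strictMono_iff_lt_succ.2 fun i => partialConeIdeal_lt p.1 i.2)
    have h2 := Order.length_le_coheight (p := t) (x := F (r 0)) (by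
      intro g hg
      have hg' := mem_coneIdeal_iff_coneRestriction.1 hg p.1 (subset_closure ⟨p, hp, rfl⟩)
      refine mem_partialConeIdeal.2 fun c _ => ?_
      rw [hg', map_zero])
    have h3 : ((Order.height (F (r 0)) + Order.coheight (F (r 0)) : ℕ∞) : WithBot ℕ∞) ≤
        (x * (n + 1) : ℕ) := by
      rw [← hdim, Order.krullDim_eq_iSup_height_add_coheight_of_nonempty]
      exact WithBot.coe_le_coe.2
        (le_iSup (fun a => Order.height a + Order.coheight a) (F (r 0)))
    have e1 : s'.length = r.length + 1 := RelSeries.cons_length ..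
    have e2 : t.length = x := rfl
    have h4 := (add_le_add h1 h2).trans (WithBot.coe_le_coe.1 h3)
    rw [e1, e2] at h4
    exact_mod_cast h4
  exact iSup_le fun r => by
    have := key r
    exact_mod_cast (show r.length ≤ d by omega)

end Zariski

/-! ### Determinants of four of the points -/

section Determinant

open MvPolynomial

variable {K : Type*} [Field K]

/-- The determinant of the coordinates of the points `e 0, …, e 3`. -/
noncomputable def detPolynomial (K : Type*) [Field K] (e : Fin 4 → Fin 5) :
    MvPolynomial (Fin 5 × Fin (3 + 1)) K :=
  Matrix.det (Matrix.of fun a b : Fin 4 => X (e a, b))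

theorem isMultihomogeneous_detPolynomial (e : Fin 4 → Fin 5) :
    IsMultihomogeneous (detPolynomial K e) := by
  refine ⟨∑ a, Pi.single (e a) 1, ?_⟩
  unfold detPolynomial
  rw [Matrix.det_apply]
  refine IsWeightedHomogeneous.sum _ _ _ fun σ _ => ?_
  have h := IsWeightedHomogeneous.prod (R := K)
    (w := fun ij : Fin 5 × Fin (3 + 1) => (Pi.single ij.1 1 : Fin 5 → ℕ)) Finset.univ
    (fun i => X (e (σ i), i)) (fun i => Pi.single (e (σ i)) 1)
    (fun i _ => isWeightedHomogeneous_X K _ (e (σ i), i))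
  rw [Equiv.sum_comp σ fun a => (Pi.single (e a) 1 : Fin 5 → ℕ)] at h
  rw [Units.smul_def]
  exact (weightedHomogeneousSubmodule K _ _).toAddSubgroup.zsmul_mem h _

theorem eval_detPolynomial (e : Fin 4 → Fin 5) (v : Fin 5 → Fin 4 → K) :
    eval (fun ij : Fin 5 × Fin (3 + 1) => v ij.1 ij.2) (detPolynomial K e) =
      Matrix.det (Matrix.of fun a => v (e a)) := by
  unfold detPolynomial
  rw [RingHom.map_det]
  congr 1
  ext a b
  simp

theorem det_ne_zero_iff_linearIndependent {v : Fin 4 → Fin 4 → K} :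
    (Matrix.of v).det ≠ 0 ↔ LinearIndependent K v := by
  rw [← isUnit_iff_ne_zero, ← Matrix.isUnit_iff_isUnit_det,
    ← Matrix.linearIndependent_rows_iff_isUnit]
  rfl

theorem detPolynomial_ne_zero {e : Fin 4 → Fin 5} (he : Function.Injective e) :
    detPolynomial K e ≠ 0 := by
  intro h
  have := eval_detPolynomial (K := K) e fun i b => if i = e b then 1 else 0
  rw [h, map_zero] at this
  have h1 : (Matrix.of fun a b : Fin 4 => if e a = e b then (1 : K) else 0) = 1 := by
    ext a b
    simp [Matrix.one_apply, he.eq_iff]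
  rw [h1, Matrix.det_one] at this
  exact zero_ne_one this

theorem OrderedPoints.Represents.mem_nonvanishingLocus_detPolynomial {p : OrderedPoints K 3 5}
    {v : Fin 5 → Fin 4 → K} (h : p.Represents v) (e : Fin 4 → Fin 5) :
    p ∈ nonvanishingLocus (detPolynomial K e) ↔ LinearIndependent K fun a => v (e a) := by
  rw [h.mem_nonvanishingLocus_iff (isMultihomogeneous_detPolynomial e), eval_detPolynomial,
    det_ne_zero_iff_linearIndependent]

theorem linearIndependent_of_not_hasRelation {V ι : Type*} [AddCommGroup V] [Module K V]
    [Fintype ι] {v : ι → V} {m : ℕ} (h : ¬ HasRelation (K := K) v m) {e : Fin m → ι}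
    (he : Function.Injective e) : LinearIndependent K fun a => v (e a) := by
  rw [Fintype.linearIndependent_iff]
  intro g hg
  by_contra! hne
  obtain ⟨a, ha⟩ := hne
  refine h ⟨Function.extend e g 0, fun h0 => ha ?_, ?_, ?_⟩
  · have := congrFun h0 (e a)
    rwa [he.extend_apply] at this
  · rw [← hg]
    symm
    refine Fintype.sum_of_injective e he _ _ (fun i hi => ?_) fun a => ?_
    · rw [Function.extend_apply' _ _ _ hi]
      simp
    · rw [he.extend_apply]
  · have : Function.support (Function.extend e g 0) ⊆ Set.range e := by
      intro i hi
      by_contra hi'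
      exact hi (Function.extend_apply' _ _ _ hi')
    refine (Set.ncard_le_ncard this (Set.finite_range e)).trans ?_
    rw [← Set.image_univ]
    refine (Set.ncard_image_le Set.finite_univ).trans ?_
    simp [Set.ncard_univ]

theorem not_linearIndependent_of_relation {V ι κ : Type*} [AddCommGroup V] [Module K V]
    [Fintype ι] [Fintype κ] {v : ι → V} {c : ι → K} (hc : c ≠ 0) (hsum : ∑ i, c i • v i = 0)
    {e : κ → ι} (he : Function.Injective e) (hsupp : Function.support c ⊆ Set.range e) :
    ¬ LinearIndependent K fun a => v (e a) := by
  rw [Fintype.not_linearIndependent_iff]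
  obtain ⟨i, hi⟩ := Function.ne_iff.1 hc
  obtain ⟨a, rfl⟩ := hsupp hi
  refine ⟨fun a => c (e a), ?_, a, hi⟩
  rw [← hsum]
  refine Fintype.sum_of_injective e he _ _ (fun i hi => ?_) fun a => rfl
  have : c i = 0 := by
    by_contra hne
    exact hi (hsupp hne)
  simp [this]

theorem topologicalKrullDim_terraciniLocus_le [CharZero K] :
    topologicalKrullDim (terraciniLocus K 3 3 5) ≤ 14 := by
  rw [← topologicalKrullDim_preimage_forgetOrder]
  have hmul : ∀ s : Finset (Fin 5),
      IsMultihomogeneous (∏ k ∈ s, detPolynomial K k.succAbove) := by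
    intro s
    choose m hm using fun k : Fin 5 => isMultihomogeneous_detPolynomial (K := K) k.succAbove
    exact ⟨_, IsWeightedHomogeneous.prod s _ m fun k _ => hm k⟩
  -- A relation on at most four vectors omits some index `k`, so the determinant of the other four
  -- vanishes. The product over all `k` is the equation of a hypersurface, and `5 * 3 = 14 + 1`.
  refine topologicalKrullDim_le_of_disjoint_nonvanishingLocus (d := 14) _ (hmul Finset.univ) ?_ ?_
    rfl
  · exact Finset.prod_ne_zero_iff.2 fun k _ => detPolynomial_ne_zero Fin.succAbove_right_injective
  · rw [Set.disjoint_left]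
    intro p hp hp'
    have h := p.represents_rep
    obtain ⟨-, c, hc, hsum, hcard⟩ := (forgetOrder_mem_terraciniLocus_iff h).1 hp
    obtain ⟨k, hk⟩ : ∃ k, c k = 0 := by
      by_contra! hne
      have : Function.support c = Set.univ := Set.eq_univ_of_forall hne
      rw [this, Set.ncard_univ, Nat.card_eq_fintype_card, Fintype.card_fin] at hcard
      omega
    have h1 : p ∈ nonvanishingLocus (detPolynomial K k.succAbove) := by
      simp only [nonvanishingLocus, Set.mem_ofPred_eq, map_prod, Finset.prod_ne_zero_iff] at hp'
      exact hp' k (Finset.mem_univ k)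
    rw [h.mem_nonvanishingLocus_detPolynomial] at h1
    refine not_linearIndependent_of_relation hc hsum Fin.succAbove_right_injective ?_ h1
    intro i hi
    rw [Fin.range_succAbove]
    rintro rfl
    exact hi hk

/-! ### The collinear locus is closed in the Terracini locus -/

/-- Since the five vectors span, three independent ones can be completed to a basis by one of the
five. So dependence of a triple is the vanishing of finitely many determinants, a closed condition.
-/
theorem hasRelation_three_iff {p : OrderedPoints K 3 5} {v : Fin 5 → Fin 4 → K}
    (h : p.Represents v) (hspan : Submodule.span K (Set.range v) = ⊤) :
    HasRelation (K := K) v 3 ↔ ∃ e : Fin 3 ↪ Fin 5, ∀ l : Fin 5,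
      p ∉ nonvanishingLocus (detPolynomial K (Fin.snoc (α := fun _ => Fin 5) e l)) := by
  have hsnoc : ∀ (e : Fin 3 ↪ Fin 5) (l : Fin 5),
      (fun a => v (Fin.snoc (α := fun _ => Fin 5) e l a)) =
        Fin.snoc (α := fun _ => Fin 4 → K) (fun a => v (e a)) (v l) := by
    intro e l
    exact Fin.comp_snoc v e l
  simp only [h.mem_nonvanishingLocus_detPolynomial, hsnoc, linearIndependent_finSnoc]
  constructor
  · rintro ⟨c, hc, hsum, hcard⟩
    have h3 : (Function.support c).ncard = 3 :=
      le_antisymm hcard (h.three_le_ncard_support hc hsum)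
    obtain ⟨f, hf⟩ := Set.powersetCard.ofFinEmb_surjective 3 (Fin 5)
      ⟨(Function.support c).toFinite.toFinset, by
        rw [Set.powersetCard.mem_iff, ← Set.ncard_eq_toFinset_card]; exact h3⟩
    refine ⟨f, fun l hl => not_linearIndependent_of_relation hc hsum f.injective ?_ hl.1⟩
    intro i hi
    rw [← Set.powersetCard.mem_ofFinEmb_iff_mem_range, hf, ← Set.powersetCard.mem_coe_iff]
    simpa using hi
  · rintro ⟨e, he⟩
    by_contra hno
    have hli := linearIndependent_of_not_hasRelation hno e.injective
    have : Submodule.span K (Set.range fun a => v (e a)) = ⊤ := by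
      rw [← top_le_iff, ← hspan, Submodule.span_le]
      rintro _ ⟨l, rfl⟩
      by_contra hl
      exact he l ⟨hli, hl⟩
    have h1 := finrank_range_le_card (R := K) fun a => v (e a)
    rw [Set.finrank, this] at h1
    simp at h1

theorem exists_isClosed_collinearTerracini_eq [CharZero K] :
    ∃ C : Set (PointSet K 3 5), IsClosed C ∧
      collinearTerracini K 3 3 5 = terraciniLocus K 3 3 5 ∩ C := by
  let D : Set (OrderedPoints K 3 5) := ⋃ e : Fin 3 ↪ Fin 5, ⋂ l : Fin 5,
    (nonvanishingLocus (detPolynomial K (Fin.snoc (α := fun _ => Fin 5) e l)))ᶜ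
  have hD : IsClosed D := isClosed_iUnion_of_finite fun e => isClosed_iInter fun l =>
    (isOpen_nonvanishingLocus (isMultihomogeneous_detPolynomial _)).isClosed_compl
  have key : ∀ p, forgetOrder K 3 5 p ∈ terraciniLocus K 3 3 5 →
      (forgetOrder K 3 5 p ∈ collinearTerracini K 3 3 5 ↔ p ∈ D) := by
    intro p hp
    have h := p.represents_rep
    rw [forgetOrder_mem_collinearTerracini_iff h, and_iff_right hp,
      hasRelation_three_iff h ((forgetOrder_mem_terraciniLocus_iff h).1 hp).1]
    simp [D]
  refine ⟨forgetOrder K 3 5 '' D, isClosedMap_forgetOrder D hD, ?_⟩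
  ext S
  constructor
  · intro hS
    obtain ⟨p, rfl⟩ := forgetOrder_surjective S
    exact ⟨hS.1, p, (key p hS.1).1 hS, rfl⟩
  · rintro ⟨hS, p, hp, rfl⟩
    exact (key p hS).2 hp

/-! ### Irreducibility of the Terracini locus -/

/-- Allowing every `a`, rather than only `0` and `1`, makes the parameter set the nonvanishing locus
of one determinant in an affine space. The variable `none` stands for `a` and `some (i, j)` for the
entries of `b`. -/
theorem isIrreducible_terraciniLocus [CharZero K] : IsIrreducible (terraciniLocus K 3 3 5) := by
  let b : Fin 4 → Fin 4 → MvPolynomial (Option (Fin 4 × Fin 4)) K := fun i j => X (some (i, j))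
  have heval : ∀ y : Option (Fin 4 × Fin 4) → K, (fun i j => eval y (configVectors b (X none) i j)) =
      configVectors (fun i j => y (some (i, j))) (y none) := by
    intro y
    funext i j
    fin_cases i <;> simp [configVectors, b]
  have hdet : ∀ y : Option (Fin 4 × Fin 4) → K, eval y (Matrix.of b).det ≠ 0 ↔
      LinearIndependent K fun i j => y (some (i, j)) := by
    intro y
    rw [RingHom.map_det, ← det_ne_zero_iff_linearIndependent]
    have : (eval y).mapMatrix (Matrix.of b) = Matrix.of fun i j => y (some (i, j)) := by
      ext i j
      simp [b]
    rw [this]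
  have hne : (Matrix.of b).det ≠ 0 := by
    intro h0
    refine (hdet fun o => o.elim 0 fun ij => Pi.basisFun K (Fin 4) ij.1 ij.2).2
      (Pi.basisFun K (Fin 4)).linearIndependent ?_
    rw [h0, map_zero]
  have hirr := OrderedPoints.isIrreducible_of_parametrization (K := K) (n := 3) (x := 5)
    (configVectors b (X none)) hne (fun y hy => by
      rw [heval]
      exact exists_represents_configVectors ((hdet y).1 hy) _)
  have himage : terraciniLocus K 3 3 5 = forgetOrder K 3 5 '' {p : OrderedPoints K 3 5 |
      ∃ y, eval y (Matrix.of b).det ≠ 0 ∧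
        p.Represents fun i j => eval y (configVectors b (X none) i j)} := by
    ext S
    constructor
    · intro hS
      obtain ⟨p, b', a, hb', -, hp, rfl⟩ := (mem_terraciniLocus_iff_configVectors S).1 hS
      refine ⟨p, ⟨fun o => o.elim a fun ij => b' ij.1 ij.2, (hdet _).2 hb', ?_⟩, rfl⟩
      rw [heval]
      exact hp
    · rintro ⟨p, ⟨y, hy, hp⟩, rfl⟩
      rw [heval] at hp
      exact (forgetOrder_mem_terraciniLocus_iff hp).2
        ⟨span_configVectors ((hdet y).1 hy) _, hasRelation_configVectors _ _⟩
  rw [himage]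
  exact hirr.image _ continuous_forgetOrder.continuousOn

end Determinant

/-! ### A chain of families of configurations with three collinear points -/

section Flag

open MvPolynomial TopologicalSpace

variable {K : Type*} [Field K]

/-- Four points of an affine chart of `ℙ³`, and a fifth point on the line through the first two. -/
def flagVectors {R : Type*} [CommRing R] (y : Fin 13 → R) : Fin 5 → Fin 4 → R :=
  ![![1, y 1, y 2, y 3], ![1, y 4, y 5, y 6], ![1, y 7, y 8, y 9], ![1, y 10, y 11, y 12],
    ![1, (1 - y 0) * y 1 + y 0 * y 4, (1 - y 0) * y 2 + y 0 * y 5, (1 - y 0) * y 3 + y 0 * y 6]]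

/-- The condition for `flagVectors y` to span and to represent distinct points. -/
def flagDiscriminant {R : Type*} [CommRing R] (y : Fin 13 → R) : R :=
  (Matrix.of fun a : Fin 4 => flagVectors y a.castSucc).det * (y 0 * (1 - y 0))

theorem map_flagVectors {R S : Type*} [CommRing R] [CommRing S] (φ : R →+* S) (y : Fin 13 → R)
    (i : Fin 5) (j : Fin 4) : φ (flagVectors y i j) = flagVectors (fun k => φ (y k)) i j := by
  fin_cases i <;> fin_cases j <;> simp [flagVectors]

theorem map_flagDiscriminant {R S : Type*} [CommRing R] [CommRing S] (φ : R →+* S)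
    (y : Fin 13 → R) : φ (flagDiscriminant y) = flagDiscriminant fun k => φ (y k) := by
  unfold flagDiscriminant
  rw [map_mul, RingHom.map_det]
  congr 1
  · congr 1
    ext a b
    exact map_flagVectors φ y a.castSucc b
  · simp

/-- Scaling the first two vectors by the nonzero factors `1 - y 0` and `y 0` turns the family into
`configVectors` with `a = 0`. -/
theorem exists_represents_flagVectors [CharZero K] {y : Fin 13 → K} (hy : flagDiscriminant y ≠ 0) :
    ∃ p : OrderedPoints K 3 5, p.Represents (flagVectors y) := by
  obtain ⟨h1, h2⟩ := mul_ne_zero_iff.1 hy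
  obtain ⟨h0, h0'⟩ := mul_ne_zero_iff.1 h2
  rw [det_ne_zero_iff_linearIndependent] at h1
  let u : Fin 4 → Kˣ := ![Units.mk0 _ h0', Units.mk0 _ h0, 1, 1]
  obtain ⟨p, hp⟩ := exists_represents_configVectors (h1.units_smul u) 0
  refine ⟨p, ?_⟩
  convert hp.smul (Fin.snoc (α := fun _ => Kˣ) u⁻¹ 1) using 1
  funext i
  fin_cases i
  · exact (inv_smul_smul (u 0) (flagVectors y 0)).symm
  · exact (inv_smul_smul (u 1) (flagVectors y 1)).symm
  · exact (inv_smul_smul (u 2) (flagVectors y 2)).symm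
  · exact (inv_smul_smul (u 3) (flagVectors y 3)).symm
  · change flagVectors y 4 = (1 : Kˣ) • ((1 - y 0) • flagVectors y 0 + y 0 • flagVectors y 1 +
      (0 : K) • _)
    rw [one_smul, zero_smul, add_zero]
    ext j
    fin_cases j <;> simp [flagVectors]

theorem forgetOrder_mem_collinearTerracini_of_flagVectors [CharZero K] {y : Fin 13 → K}
    (hy : flagDiscriminant y ≠ 0) {p : OrderedPoints K 3 5} (hp : p.Represents (flagVectors y)) :
    forgetOrder K 3 5 p ∈ collinearTerracini K 3 3 5 := by
  obtain ⟨h1, -⟩ := mul_ne_zero_iff.1 hy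
  rw [det_ne_zero_iff_linearIndependent] at h1
  have hrel : ∑ i, (![1 - y 0, y 0, 0, 0, -1] : Fin 5 → K) i • flagVectors y i = 0 := by
    ext j
    fin_cases j <;> simp [flagVectors, Fin.sum_univ_five]
  have hne : (![1 - y 0, y 0, 0, 0, -1] : Fin 5 → K) ≠ 0 := fun h => by
    simpa using congrFun h 4
  have hcard : (Function.support (![1 - y 0, y 0, 0, 0, -1] : Fin 5 → K)).ncard ≤ 3 := by
    have : Function.support (![1 - y 0, y 0, 0, 0, -1] : Fin 5 → K) ⊆
        (({0, 1, 4} : Finset (Fin 5)) : Set (Fin 5)) := by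
      intro i hi
      fin_cases i <;> simp at hi ⊢
    refine (Set.ncard_le_ncard this (Finset.finite_toSet _)).trans ?_
    rw [Set.ncard_coe_finset]
    decide
  rw [forgetOrder_mem_collinearTerracini_iff hp, forgetOrder_mem_terraciniLocus_iff hp]
  refine ⟨⟨?_, _, hne, hrel, by omega⟩, _, hne, hrel, hcard⟩
  rw [← top_le_iff, ← h1.span_eq_top_of_card_eq_finrank (by simp)]
  refine Submodule.span_mono ?_
  rintro _ ⟨a, rfl⟩
  exact ⟨a.castSucc, rfl⟩

/-- The parameters of a configuration consisting of the vertices of the standard simplex and a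
point on one of its edges. -/
def flagBase (K : Type*) [Field K] : Fin 13 → K := ![2, 0, 0, 0, 1, 0, 0, 0, 1, 0, 0, 0, 1]

/-- The coordinate of `flagVectors y` that gives the parameter `y k`. -/
def flagPosition : Fin 13 → Fin 5 × Fin 4 :=
  ![(4, 1), (0, 1), (0, 2), (0, 3), (1, 1), (1, 2), (1, 3), (2, 1), (2, 2), (2, 3), (3, 1), (3, 2),
    (3, 3)]

/-- Parameter `0` is not itself a coordinate, but it equals the coordinate `(4, 1)` as long as `y 1
= 0` and `y 4 = 1`. This is why it is released first, while the edge is still fixed. -/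
theorem flagVectors_position {y : Fin 13 → K} {k : Fin 13} (h : ∀ j, k ≤ j → y j = flagBase K j) :
    flagVectors y (flagPosition k).1 (flagPosition k).2 = flagBase K k := by
  have hk := h k le_rfl
  by_cases h0 : k = 0
  · subst h0
    have h1 := h 1 (by decide)
    have h4 := h 4 (by decide)
    simp [flagVectors, flagPosition, flagBase] at hk h1 h4 ⊢
    rw [hk, h1, h4]
    ring
  · rw [← hk]
    fin_cases k <;> simp_all [flagVectors, flagPosition]

theorem flagVectors_zero (y : Fin 13 → K) (i : Fin 5) : flagVectors y i 0 = 1 := by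
  fin_cases i <;> rfl

theorem flagDiscriminant_base [CharZero K] : flagDiscriminant (flagBase K) ≠ 0 := by
  simp [flagDiscriminant, flagVectors, flagBase, Matrix.det_succ_row_zero, Fin.sum_univ_succ,
    Fin.succAbove]
  norm_num

/-- The shift is by `2` because a shift by `1` of parameter `1`, `2` or `3` would move the first
vertex onto another one. -/
theorem flagDiscriminant_update [CharZero K] (k : Fin 13) :
    flagDiscriminant (Function.update (flagBase K) k (flagBase K k + 2)) ≠ 0 := by
  fin_cases k <;>
  simp [flagDiscriminant, flagVectors, flagBase, Matrix.det_succ_row_zero, Fin.sum_univ_succ,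
    Fin.succAbove, Function.update] <;> norm_num

theorem flagVectors_update [CharZero K] (k : Fin 13) :
    flagVectors (Function.update (flagBase K) k (flagBase K k + 2)) (flagPosition k).1
      (flagPosition k).2 ≠ flagBase K k := by
  fin_cases k <;>
  simp [flagVectors, flagBase, flagPosition, Function.update]

end Flag

/-! ### Dimensions -/

section Dimension

open MvPolynomial TopologicalSpace

/-- A chain in a proper closed subset of an irreducible space can be extended by the whole space. -/
theorem topologicalKrullDim_add_one_le {Y Z : Type*} [TopologicalSpace Y] [TopologicalSpace Z]
    [IrreducibleSpace Z] {f : Y → Z} (hf : Topology.IsInducing f) (hc : IsClosed (Set.range f))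
    (hne : Set.range f ≠ Set.univ) {d : ℕ} (hd : (d : WithBot ℕ∞) ≤ topologicalKrullDim Y) :
    ((d + 1 : ℕ) : WithBot ℕ∞) ≤ topologicalKrullDim Z := by
  obtain ⟨l, rfl⟩ := Order.le_krullDim_iff.1 hd
  let t : IrreducibleCloseds Z := ⟨Set.univ, IrreducibleSpace.isIrreducible_univ Z, isClosed_univ⟩
  refine Order.le_krullDim_iff.2
    ⟨(l.map _ (IrreducibleCloseds.map_strictMono_of_isInducing hf)).snoc t ?_, rfl⟩
  rw [LTSeries.last_map]
  change _ < t
  rw [← SetLike.coe_ssubset_coe]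
  refine Set.ssubset_univ_iff.2 fun h => hne ?_
  rw [← Set.univ_subset_iff, ← h]
  exact closure_minimal (Set.image_subset_range _ _) hc

variable {K : Type*} [Field K]

theorem exists_mem_terraciniLocus_notMem_collinearTerracini [CharZero K] :
    ∃ S ∈ terraciniLocus K 3 3 5, S ∉ collinearTerracini K 3 3 5 := by
  obtain ⟨S, hS, h, -⟩ := exists_forgetOrder_mem_terraciniLocus (1 : K) (Or.inr rfl)
  exact ⟨S, hS, fun hS' => one_ne_zero (h.1 hS')⟩

/-- The tuples represented by `flagVectors y`, where only the first `k` parameters vary. -/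
def flagFamily (K : Type*) [Field K] (k : ℕ) : Set (OrderedPoints K 3 5) :=
  {p | ∃ y : Fin 13 → K, (∀ j : Fin 13, k ≤ j → y j = flagBase K j) ∧ flagDiscriminant y ≠ 0 ∧
    p.Represents (flagVectors y)}

theorem flagFamily_mono : Monotone (flagFamily K) := fun _ _ h _ ⟨y, hy, hp⟩ =>
  ⟨y, fun j hj => hy j (h.trans hj), hp⟩

theorem isIrreducible_flagFamily [CharZero K] (k : ℕ) : IsIrreducible (flagFamily K k) := by
  let s : Fin 13 → MvPolynomial (Fin 13) K := fun j => if j < k then X j else C (flagBase K j)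
  have hs : ∀ y : Fin 13 → K, (fun j => eval y (s j)) =
      fun j : Fin 13 => if j < k then y j else flagBase K j := by
    intro y
    funext j
    by_cases hj : (j : ℕ) < k <;> simp [s, hj]
  have hV : ∀ y : Fin 13 → K, (fun i j => eval y (flagVectors s i j)) =
      flagVectors fun j : Fin 13 => if j < k then y j else flagBase K j := by
    intro y
    funext i j
    rw [map_flagVectors, hs]
  have hD : ∀ y : Fin 13 → K, eval y (flagDiscriminant s) =
      flagDiscriminant fun j : Fin 13 => if j < k then y j else flagBase K j := by
    intro y
    rw [map_flagDiscriminant, hs]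
  have h0 : flagDiscriminant s ≠ 0 := fun h => by
    apply flagDiscriminant_base (K := K)
    have := hD (flagBase K)
    simpa [h] using this.symm
  convert OrderedPoints.isIrreducible_of_parametrization (flagVectors s) h0 fun y hy => ?_ using 1
  · ext p
    simp only [hV, hD]
    constructor
    · rintro ⟨y, hy, hyD, hp⟩
      have : (fun j : Fin 13 => if j < k then y j else flagBase K j) = y := by
        funext j
        split_ifs with hj
        · rfl
        · exact (hy j (not_lt.1 hj)).symm
      exact ⟨y, by rwa [this], by rwa [this]⟩
    · rintro ⟨y, hyD, hp⟩
      exact ⟨_, fun j hj => if_neg (not_lt.2 hj), hyD, hp⟩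
  · rw [hV]
    rw [hD] at hy
    exact exists_represents_flagVectors hy

/-- As the zeroth coordinates are `1`, the linear form `f` compares the coordinate of parameter `k`
with its base value. It vanishes while that parameter is fixed and is nonzero at one member of the
next family. -/
theorem exists_isOpen_flagFamily [CharZero K] (k : Fin 13) : ∃ U : Set (OrderedPoints K 3 5),
    IsOpen U ∧ Disjoint (flagFamily K k) U ∧ (flagFamily K (k + 1) ∩ U).Nonempty := by
  let f : MvPolynomial (Fin 5 × Fin (3 + 1)) K :=
    X (flagPosition k) - C (flagBase K k) * X ((flagPosition k).1, 0)
  have hf : IsMultihomogeneous f := by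
    refine ⟨Pi.single (flagPosition k).1 1, ?_⟩
    refine (weightedHomogeneousSubmodule K _ _).sub_mem (isWeightedHomogeneous_X K _ _) ?_
    rw [mem_weightedHomogeneousSubmodule]
    simpa using (isWeightedHomogeneous_C _ (flagBase K k)).mul
      (isWeightedHomogeneous_X K (fun ij : Fin 5 × Fin (3 + 1) =>
        (Pi.single ij.1 1 : Fin 5 → ℕ)) ((flagPosition k).1, 0))
  have heval : ∀ y : Fin 13 → K, eval (fun ij => flagVectors y ij.1 ij.2) f =
      flagVectors y (flagPosition k).1 (flagPosition k).2 - flagBase K k := by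
    intro y
    simp only [f, map_sub, map_mul, eval_X, eval_C]
    rw [flagVectors_zero, mul_one]
  refine ⟨_, isOpen_nonvanishingLocus hf, Set.disjoint_left.2 ?_, ?_⟩
  · rintro p ⟨y, hy, -, hp⟩
    rw [hp.mem_nonvanishingLocus_iff hf, heval, flagVectors_position fun j hj => hy j hj]
    simp
  · obtain ⟨p, hp⟩ := exists_represents_flagVectors (flagDiscriminant_update (K := K) k)
    refine ⟨p, ⟨_, fun j hj => ?_, flagDiscriminant_update k, hp⟩, ?_⟩
    · exact Function.update_of_ne (by rintro rfl; omega) _ _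
    · rw [hp.mem_nonvanishingLocus_iff hf, heval]
      exact sub_ne_zero.2 (flagVectors_update k)

theorem IsIrreducible.preimage_val {X : Type*} [TopologicalSpace X] {Y A : Set X}
    (hA : IsIrreducible A) (h : A ⊆ Y) : IsIrreducible ((↑) ⁻¹' A : Set Y) := by
  have := Subtype.irreducibleSpace hA
  convert (IrreducibleSpace.isIrreducible_univ A).image (Set.inclusion h)
    (continuous_inclusion h).continuousOn using 1
  rw [Set.image_univ, Set.range_inclusion]
  rfl

/-- Releasing the 13 parameters one at a time gives 14 irreducible families whose closures increase
strictly, the open sets of `exists_isOpen_flagFamily` separating consecutive ones. -/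
theorem le_topologicalKrullDim_collinearTerracini [CharZero K] :
    13 ≤ topologicalKrullDim (collinearTerracini K 3 3 5) := by
  rw [← topologicalKrullDim_preimage_forgetOrder]
  set Y := forgetOrder K 3 5 ⁻¹' collinearTerracini K 3 3 5
  have hY : ∀ k, flagFamily K k ⊆ Y := fun k p ⟨y, _, hy, hp⟩ =>
    forgetOrder_mem_collinearTerracini_of_flagVectors hy hp
  let W : Fin 14 → IrreducibleCloseds Y := fun k => ⟨closure ((↑) ⁻¹' flagFamily K k),
    ((isIrreducible_flagFamily (k : ℕ)).preimage_val (hY k)).closure, isClosed_closure⟩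
  have hW : StrictMono W := by
    refine Fin.strictMono_iff_lt_succ.2 fun k => ?_
    rw [← SetLike.coe_ssubset_coe]
    refine ⟨closure_mono (Set.preimage_mono (flagFamily_mono (by simp))), fun hle => ?_⟩
    obtain ⟨U, hU, hdisj, p, hp, hpU⟩ := exists_isOpen_flagFamily (K := K) k
    have h1 : (⟨p, hY _ hp⟩ : Y) ∈ closure ((↑) ⁻¹' flagFamily K k : Set Y) :=
      hle (subset_closure hp)
    obtain ⟨q, hqU, hq⟩ := mem_closure_iff.1 h1 _ (hU.preimage continuous_subtype_val) hpU
    exact Set.disjoint_left.1 hdisj hq hqU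
  exact_mod_cast Order.le_krullDim_iff.2 ⟨⟨13, W, fun i => hW i.castSucc_lt_succ⟩, rfl⟩

theorem add_one_le_topologicalKrullDim_terraciniLocus [CharZero K] {d : ℕ}
    (hd : (d : WithBot ℕ∞) ≤ topologicalKrullDim (collinearTerracini K 3 3 5)) :
    ((d + 1 : ℕ) : WithBot ℕ∞) ≤ topologicalKrullDim (terraciniLocus K 3 3 5) := by
  obtain ⟨C, hC, hCeq⟩ := exists_isClosed_collinearTerracini_eq (K := K)
  have hsub : collinearTerracini K 3 3 5 ⊆ terraciniLocus K 3 3 5 := fun S hS => hS.1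
  have := Subtype.irreducibleSpace (isIrreducible_terraciniLocus (K := K))
  refine topologicalKrullDim_add_one_le (Topology.IsEmbedding.inclusion hsub |>.isInducing) ?_ ?_ hd
  · rw [Set.range_inclusion]
    convert hC.preimage continuous_subtype_val using 1
    ext S
    simp [hCeq]
  · rw [Set.range_inclusion]
    intro h
    obtain ⟨S, hS, hS'⟩ := exists_mem_terraciniLocus_notMem_collinearTerracini (K := K)
    exact hS' (Set.eq_univ_iff_forall.1 h ⟨S, hS⟩)

theorem topologicalKrullDim_terraciniLocus [CharZero K] :
    topologicalKrullDim (terraciniLocus K 3 3 5) = 14 :=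
  topologicalKrullDim_terraciniLocus_le.antisymm <| by
    exact_mod_cast add_one_le_topologicalKrullDim_terraciniLocus (d := 13)
      (by exact_mod_cast le_topologicalKrullDim_collinearTerracini)

theorem topologicalKrullDim_collinearTerracini [CharZero K] :
    topologicalKrullDim (collinearTerracini K 3 3 5) = 13 := by
  -- If `Φ` had dimension at least 14, the Terracini locus would have dimension at least 15.
  refine le_antisymm (not_lt.1 fun h => ?_) le_topologicalKrullDim_collinearTerracini
  have h1 : ((14 : ℕ) : WithBot ℕ∞) ≤ topologicalKrullDim (collinearTerracini K 3 3 5) := by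
    have := ENat.WithBot.add_one_le_iff (n := 13).2 h
    exact_mod_cast this
  have h2 := add_one_le_topologicalKrullDim_terraciniLocus h1
  rw [topologicalKrullDim_terraciniLocus] at h2
  exact absurd h2 (by decide)

theorem isOpen_terraciniLocus_diff_collinearTerracini [CharZero K] :
    IsOpen ((↑) ⁻¹' (terraciniLocus K 3 3 5 \ collinearTerracini K 3 3 5) :
      Set (terraciniLocus K 3 3 5)) := by
  obtain ⟨C, hC, hCeq⟩ := exists_isClosed_collinearTerracini_eq (K := K)
  convert hC.isOpen_compl.preimage continuous_subtype_val using 1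
  ext S
  simp [hCeq]

end Dimension

theorem proposition3p11 (K : Type*) [Field K] [IsAlgClosed K] [CharZero K] :
    -- the Terracini locus is irreducible of dimension 14
    (IsIrreducible (terraciniLocus K 3 3 5) ∧
      topologicalKrullDim (terraciniLocus K 3 3 5) = 14) ∧
    -- it consists of the spanning sets four of whose points are coplanar
    (∀ S : PointSet K 3 5, S ∈ terraciniLocus K 3 3 5 ↔
      S.Spans ∧ ∃ A ⊆ S.1, A.card = 4 ∧ IsCoplanar (A : Set (ℙ K (Fin (3 + 1) → K)))) ∧
    -- it is invariant under PGL(4)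
    (∀ g : Matrix.ProjGenLinGroup (Fin (3 + 1)) K, ∀ S ∈ terraciniLocus K 3 3 5,
      g • S ∈ terraciniLocus K 3 3 5) ∧
    -- the orbits contained in it are `Φ` and its complement, and these are distinct
    (MulAction.orbit (Matrix.ProjGenLinGroup (Fin (3 + 1)) K) '' terraciniLocus K 3 3 5 =
      {collinearTerracini K 3 3 5, terraciniLocus K 3 3 5 \ collinearTerracini K 3 3 5} ∧
      collinearTerracini K 3 3 5 ≠ terraciniLocus K 3 3 5 \ collinearTerracini K 3 3 5) ∧
    -- `Φ` has dimension 13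
    topologicalKrullDim (collinearTerracini K 3 3 5) = 13 ∧
    -- the complement of `Φ` is open in the Terracini locus
    IsOpen ((↑) ⁻¹' (terraciniLocus K 3 3 5 \ collinearTerracini K 3 3 5) :
      Set (terraciniLocus K 3 3 5)) := by
  exact ⟨⟨isIrreducible_terraciniLocus, topologicalKrullDim_terraciniLocus⟩,
    mem_terraciniLocus_iff_isCoplanar, fun g _ hS => smul_mem_terraciniLocus g hS,
    orbits_terraciniLocus, topologicalKrullDim_collinearTerracini,
    isOpen_terraciniLocus_diff_collinearTerracini⟩
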